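/- A vertex operator algebra (VOA) is a complex vector space $V=\bigoplus_{n\in\mathbb Z}V_n$ with all $V_n$ finite-dimensional and $V_n=0$ for $n\ll 0$, together with a linear map $u\mapsto Y(u,z)=\sum_{n\in\mathbb Z}u(n)z^{-n-1}\in \mathrm{End}(V)[[z,z^{-1}]]$ (where, for all $u,v$, $u(n)v=0$ for $n\gg 0$), a vacuum vector $\mathbf 1$ and a conformal vector $\omega$ satisfying the usual axioms: $Y(\mathbf 1,z)=\mathrm{Id}_V$, $Y(u,z)\mathbf 1\in u+zV[[z]]$, the Jacobi identity, the Virasoro relations for the operators $L(n)=\omega(n+1)$ with some central charge $c\in\mathbb C$, $L(0)|_{V_n}=n$, and $Y(L(-1)u,z)=\frac{d}{dz}Y(u,z)$. It is simple if $V\neq 0$ and $V$ has no ideals other than $0$ and $V$. An automorphism of $V$ is an invertible linear map that fixes $\mathbf 1$ and $\omega$ and preserves all products $u(n)v$; these form the group $\mathrm{Aut}(V)$. The space $V_1$ is a finite-dimensional left Leibniz algebra with bracket $[uv]=u(0)v$, i.e. $[a[bc]]=[[ab]c]+[b[ac]]$. A Levi subalgebra of a finite-dimensional left Leibniz algebra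 $A$ is a subalgebra $S\subseteq A$ that is a semisimple Lie algebra and satisfies $A=S\oplus B$ as vector spaces, where $B$ is the solvable radical of $A$ (its largest solvable two-sided ideal). **Theorem.** Let $V$ be a simple VOA (with no restriction on the conformal grading beyond the above). Let $N=\langle a(0)a \mid a\in V_1\rangle$ (linear span) be the Leibniz kernel of $V_1$, and let $F=\{a\in V_1\mid a(0)N=0\}$ be its annihilator, which is a Leibniz subalgebra of $V_1$. Then: (a) $\mathrm{Aut}(V)$ acts transitively on the Levi subalgebras of $F$: if $g\in\mathrm{Aut}(V)$ and $S$ is a Levi subalgebra of $F$ then so is $g(S)$, and for any two Levi subalgebras $S_1,S_2$ of $F$ there is $g\in\mathrm{Aut}(V)$ with $g(S_1)=S_2$. (b) Let $S$ be a Levi subalgebra of $F$. Then $u(1)v\in\mathbb C\mathbf 1$ for all $u,v\in S$, and the vertex operators $Y(u,z)$ $(u\in S)$ close on an affine algebra, i.e. there is a bilinear form $\alpha:S\times S\to\mathbb C$ with $u(1)v=\alpha(u,v)\mathbf 1$ and $$[u(m),v(n)]=(u(0)v)(m+n)+m\,\alpha(u,v)\,\delta_{m+n,0}\,\mathrm{Id}_V\qquad(u,v\in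 S,\ m,n\in\mathbb Z).$$ -/

import Mathlib

noncomputable section

namespace LeibnizAlg

variable {L : Type*} [AddCommGroup L] [Module ℂ L]

/-- A bilinear bracket `β` makes `L` a left Leibniz algebra: `[a[bc]] = [[ab]c] + [b[ac]]`. -/
def IsLeftLeibniz (β : L →ₗ[ℂ] L →ₗ[ℂ] L) : Prop :=
  ∀ a b c : L, β a (β b c) = β (β a b) c + β b (β a c)

/-- The subspace `A` is closed under the bracket. -/
def IsSubalgebra (β : L →ₗ[ℂ] L →ₗ[ℂ] L) (A : Submodule ℂ L) : Prop :=
  ∀ a ∈ A, ∀ b ∈ A, β a b ∈ A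

/-- `I` is a two-sided ideal of the subalgebra `A`. -/
def IsIdealOf (β : L →ₗ[ℂ] L →ₗ[ℂ] L) (A I : Submodule ℂ L) : Prop :=
  I ≤ A ∧ ∀ a ∈ A, ∀ x ∈ I, β a x ∈ I ∧ β x a ∈ I

/-- The derived series: `A⁽⁰⁾ = A`, and `A⁽ᵏ⁺¹⁾` is the span of all `[xy]` with `x, y ∈ A⁽ᵏ⁾`. -/
def derivedSeries (β : L →ₗ[ℂ] L →ₗ[ℂ] L) (A : Submodule ℂ L) : ℕ → Submodule ℂ L
  | 0 => A
  | k + 1 => Submodule.map₂ β (derivedSeries β A k) (derivedSeries β A k)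

/-- `A` is solvable: some term of the derived series vanishes. -/
def IsSolvable (β : L →ₗ[ℂ] L →ₗ[ℂ] L) (A : Submodule ℂ L) : Prop :=
  ∃ k : ℕ, derivedSeries β A k = ⊥

/-- The solvable radical of `A`: the sum of all solvable two-sided ideals of `A`
(for finite-dimensional `A` this is the largest solvable ideal). -/
def solvableRadical (β : L →ₗ[ℂ] L →ₗ[ℂ] L) (A : Submodule ℂ L) : Submodule ℂ L :=
  sSup {I : Submodule ℂ L | IsIdealOf β A I ∧ IsSolvable β I}

/-- A subalgebra of a left Leibniz algebra on which the bracket is alternating is a Lie ring. -/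
abbrev lieRing {β : L →ₗ[ℂ] L →ₗ[ℂ] L} (hβ : IsLeftLeibniz β) {S : Submodule ℂ L}
    (hS : IsSubalgebra β S) (halt : ∀ a ∈ S, β a a = 0) : LieRing S :=
  { (inferInstance : AddCommGroup S) with
    bracket := fun a b => ⟨β a b, hS a a.2 b b.2⟩
    add_lie := fun a b c => Subtype.ext (by simp)
    lie_add := fun a b c => Subtype.ext (by simp)
    lie_self := fun a => Subtype.ext (halt a a.2)
    leibniz_lie := fun a b c => Subtype.ext (hβ a b c) }

/-- A subalgebra of a left Leibniz algebra on which the bracket is alternating is a complex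
Lie algebra. -/
abbrev lieAlgebra {β : L →ₗ[ℂ] L →ₗ[ℂ] L} (hβ : IsLeftLeibniz β) {S : Submodule ℂ L}
    (hS : IsSubalgebra β S) (halt : ∀ a ∈ S, β a a = 0) :
    @LieAlgebra ℂ S _ (lieRing hβ hS halt) :=
  letI := lieRing hβ hS halt
  { (inferInstance : Module ℂ S) with
    lie_smul := fun t a b => Subtype.ext ((β (a : L)).map_smul t (b : L)) }

/-- `S` is a Levi subalgebra of `A`: it is a semisimple Lie subalgebra, and `A = S ⊕ B` as a
vector space, where `B` is the solvable radical of `A`. -/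
structure IsLeviSubalgebra {β : L →ₗ[ℂ] L →ₗ[ℂ] L} (hβ : IsLeftLeibniz β)
    (A S : Submodule ℂ L) : Prop where
  isSubalgebra : IsSubalgebra β S
  alternating : ∀ a ∈ S, β a a = 0
  isSemisimple : @LieAlgebra.IsSemisimple ℂ S _ (lieRing hβ isSubalgebra alternating)
    (lieAlgebra hβ isSubalgebra alternating)
  inf_eq : S ⊓ solvableRadical β A = ⊥
  sup_eq : S ⊔ solvableRadical β A = A

end LeibnizAlg

/-- For a state-field map `Y`, the mode `u(n)` in `Y(u,z) = ∑ u(n) z^(-n-1)`, linear in `u`. -/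
def vertexMode {V : Type*} [AddCommGroup V] [Module ℂ V] (Y : V →ₗ[ℂ] VertexOperator ℂ V)
    (n : ℤ) : V →ₗ[ℂ] Module.End ℂ V :=
  LinearMap.proj n ∘ₗ VertexOperator.ncoeff ∘ₗ Y

/-- A vertex operator algebra structure `(V, Y, 𝟏, ω)` on a complex vector space `V`. That
`u(n)v = 0` for `n` large is part of the type of `Y`. -/
structure VertexOperatorAlgebra (V : Type*) [AddCommGroup V] [Module ℂ V] where
  /-- the state-field correspondence `u ↦ Y(u,z)` -/
  Y : V →ₗ[ℂ] VertexOperator ℂ V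
  /-- the vacuum vector `𝟏` -/
  vacuum : V
  /-- the conformal vector `ω`; its modes are `L(n) = ω(n+1)` -/
  conformal : V
  /-- the central charge -/
  centralCharge : ℂ
  /-- the homogeneous spaces `V_n` -/
  weightSpace : ℤ → Submodule ℂ V
  isInternal : DirectSum.IsInternal weightSpace
  finiteDimensional : ∀ n, FiniteDimensional ℂ (weightSpace n)
  bounded_below : ∃ n₀ : ℤ, ∀ n < n₀, weightSpace n = ⊥
  /-- `Y(𝟏,z) = id` -/
  vacuum_mode : ∀ n : ℤ, vertexMode Y n vacuum = if n = -1 then LinearMap.id else 0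
  /-- `Y(u,z)𝟏` is a power series in `z` with constant term `u` -/
  mode_vacuum : ∀ (u : V) (n : ℤ), -1 ≤ n →
    vertexMode Y n u vacuum = if n = -1 then u else 0
  /-- the Jacobi identity, in components; all three sums have finite support -/
  jacobi : ∀ (u v w : V) (p q r : ℤ),
    ∑ᶠ i : ℕ, ((Ring.choose p i : ℤ) : ℂ) •
        vertexMode Y (p + q - i) (vertexMode Y (r + i) u v) w =
      ∑ᶠ i : ℕ, ((-1 : ℂ) ^ i * ((Ring.choose r i : ℤ) : ℂ)) •
        vertexMode Y (p + r - i) u (vertexMode Y (q + i) v w) -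
      ∑ᶠ i : ℕ, ((-1 : ℂ) ^ r * (-1 : ℂ) ^ i * ((Ring.choose r i : ℤ) : ℂ)) •
        vertexMode Y (q + r - i) v (vertexMode Y (p + i) u w)
  /-- the Virasoro relations for `L(n) = ω(n+1)` -/
  virasoro : ∀ m n : ℤ,
    ⁅vertexMode Y (m + 1) conformal, vertexMode Y (n + 1) conformal⁆ =
      ((m : ℂ) - n) • vertexMode Y (m + n + 1) conformal +
        (if m + n = 0 then ((m : ℂ) ^ 3 - m) / 12 * centralCharge else 0) • LinearMap.id
  /-- `V_n` is the space of states of conformal weight `n` -/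
  weight_eq : ∀ (n : ℤ), ∀ v ∈ weightSpace n, vertexMode Y 1 conformal v = (n : ℂ) • v
  /-- `Y(L(-1)u,z)` is the derivative of `Y(u,z)` -/
  translation : ∀ (u : V) (n : ℤ),
    vertexMode Y n (vertexMode Y 0 conformal u) = (-(n : ℂ)) • vertexMode Y (n - 1) u

namespace VertexOperatorAlgebra

variable {V : Type*} [AddCommGroup V] [Module ℂ V] (𝒱 : VertexOperatorAlgebra V)

/-- The mode `u(n)`. -/
abbrev mode (u : V) (n : ℤ) : Module.End ℂ V := vertexMode 𝒱.Y n u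

/-- `V` is simple: it is irreducible as a module over itself, i.e. it is nonzero and its only
subspaces stable under all modes `u(n)` are `0` and `V`. (By skew-symmetry of `Y` such subspaces
are the same as two-sided ideals.) -/
def IsSimple : Prop :=
  Nontrivial V ∧ ∀ I : Submodule ℂ V,
    (∀ (u : V) (n : ℤ), ∀ x ∈ I, 𝒱.mode u n x ∈ I) → I = ⊥ ∨ I = ⊤

/-- The `0`-th product `[uv] = u(0)v`. -/
def bracket : V →ₗ[ℂ] V →ₗ[ℂ] V := vertexMode 𝒱.Y 0

/-- The `0`-th product makes `V` a left Leibniz algebra. -/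
theorem isLeftLeibniz_bracket : LeibnizAlg.IsLeftLeibniz 𝒱.bracket := by
  intro a b c
  have h := 𝒱.jacobi a b c 0 0 0
  rw [finsum_eq_single _ 0, finsum_eq_single _ 0, finsum_eq_single _ 0] at h
  · simp at h
    exact (eq_add_of_sub_eq h.symm)
  all_goals
    intro i hi
    simp [Ring.choose_zero_ite, hi]

/-- The Leibniz kernel `N` of `V_1`: the span of all `a(0)a` with `a ∈ V_1`. -/
def leibnizKernel : Submodule ℂ V :=
  Submodule.span ℂ {x | ∃ a ∈ 𝒱.weightSpace 1, x = 𝒱.bracket a a}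

/-- The annihilator `F = {a ∈ V_1 | a(0)N = 0}` of the Leibniz kernel. -/
def kernelAnnihilator : Submodule ℂ V where
  carrier := {a | a ∈ 𝒱.weightSpace 1 ∧ ∀ x ∈ 𝒱.leibnizKernel, 𝒱.bracket a x = 0}
  zero_mem' := ⟨Submodule.zero_mem _, fun x _ => by simp⟩
  add_mem' := fun ha hb =>
    ⟨Submodule.add_mem _ ha.1 hb.1, fun x hx => by simp [ha.2 x hx, hb.2 x hx]⟩
  smul_mem' := fun t _ ha =>
    ⟨Submodule.smul_mem _ t ha.1, fun x hx => by simp [ha.2 x hx]⟩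

/-- `S` is a Levi subalgebra of the Leibniz algebra `F`. -/
def IsLevi (S : Submodule ℂ V) : Prop :=
  LeibnizAlg.IsLeviSubalgebra 𝒱.isLeftLeibniz_bracket 𝒱.kernelAnnihilator S

/-- The automorphism group `Aut(V)`: the linear automorphisms of `V` that fix `𝟏` and `ω` and
respect all products `u(n)v`. -/
def aut : Subgroup (V ≃ₗ[ℂ] V) where
  carrier := {g | g 𝒱.vacuum = 𝒱.vacuum ∧ g 𝒱.conformal = 𝒱.conformal ∧
    ∀ (u v : V) (n : ℤ), g (𝒱.mode u n v) = 𝒱.mode (g u) n (g v)}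
  one_mem' := ⟨rfl, rfl, fun _ _ _ => rfl⟩
  mul_mem' := by
    rintro g h ⟨g1, g2, g3⟩ ⟨h1, h2, h3⟩
    exact ⟨by simp [h1, g1], by simp [h2, g2], fun u v n => by simp [h3, g3]⟩
  inv_mem' := by
    rintro g ⟨g1, g2, g3⟩
    refine ⟨g.injective ?_, g.injective ?_, fun u v n => g.injective ?_⟩
    · exact (g.apply_symm_apply _).trans g1.symm
    · exact (g.apply_symm_apply _).trans g2.symm
    · rw [g3]
      change g (g.symm _) = 𝒱.mode (g (g.symm u)) n (g (g.symm v))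
      simp

end VertexOperatorAlgebra

end

/-!
A Levi subalgebra `S` of `F` is perfect, so for `x ∈ S` the operator `x(0)` kills a vector `z` as
soon as all `u(0)v(0)` with `u, v ∈ S` do. For `z ∈ V_0` the vector `v(0)L(-1)z` lies in `N`, which
`F` annihilates; hence `x(0)` kills `L(-1)z`, therefore `z`, and by descending induction all `V_k`
with `k ≤ 0`. By perfectness again the same holds for all `x(n)` with `n ≥ 0`. Consequently every
`a ∈ [S, V_1]` is primary, so `a(0)ω = 0`, and `exp a(0)`, which exists because `a(0)` preserves the
finite-dimensional spaces `V_n`, is an automorphism of `V`.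

Transitivity then follows as in Malcev's theorem. Let `B` be the solvable radical of `F`, and
suppose `S₁ ⊆ S₂ + I` with `I = B⁽ᵏ⁾ + N`; put `J = B⁽ᵏ⁺¹⁾ + N`. The projection to `I` along `S₂`
restricts to a cocycle of `S₁` in `([S₁, I] + J) / J`, which is a coboundary by Whitehead's first
lemma, so `exp a(0)` moves `S₁` into `S₂ + J` for some `a ∈ [S₁, I]`. The induction ends with
`S₁ ⊆ S₂ + N`, where `N` is central in `F`; taking brackets gives `S₁ = [S₁, S₁] ⊆ S₂`.

For the affine relations, `u(i)v = 0` for `i ≥ 2`, and skew-symmetry together with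
`u(0)v = -v(0)u` forces `L(-1)u(1)v = 0`. A vector in the kernel of `L(-1)` has a single nonzero
mode, which commutes with all vertex operators, so by Schur's lemma it is a multiple of `𝟏`.
-/

/-! ### Whitehead's first lemma -/

section Perfect

variable {K L : Type*} [CommRing K] [LieRing L] [LieAlgebra K L] [LieAlgebra.IsSemisimple K L]

theorem lie_top_top_of_isSemisimple :
    (⁅(⊤ : LieIdeal K L), (⊤ : LieIdeal K L)⁆ : LieIdeal K L) = ⊤ := by
  obtain ⟨J, hJ⟩ := exists_isCompl (⁅(⊤ : LieIdeal K L), (⊤ : LieIdeal K L)⁆ : LieIdeal K L)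
  have hJJ : (⁅J, J⁆ : LieIdeal K L) = ⊥ :=
    le_bot_iff.1 <| hJ.disjoint (LieSubmodule.mono_lie le_top le_top) (LieSubmodule.lie_le_left J J)
  have : IsLieAbelian J := (LieSubmodule.lie_abelian_iff_lie_self_eq_bot J).2 hJJ
  simpa [LieAlgebra.HasTrivialRadical.eq_bot_of_isSolvable J] using hJ.sup_eq_top

theorem eq_top_of_forall_lie_mem {p : Submodule K L} (hp : ∀ x y : L, ⁅x, y⁆ ∈ p) : p = ⊤ := by
  rw [eq_top_iff, ← LieSubmodule.top_toSubmodule (R := K) (L := L) (M := L),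
    ← lie_top_top_of_isSemisimple, LieSubmodule.lieIdeal_oper_eq_linear_span', Submodule.span_le]
  rintro _ ⟨x, -, y, -, rfl⟩
  exact hp x y

end Perfect

section DualContraction

variable {K L I M : Type*} [Field K] [LieRing L] [LieAlgebra K L]
  [AddCommGroup I] [Module K I] [FiniteDimensional K I] [LieRingModule L I] [LieModule K L I]
  [AddCommGroup M] [Module K M] [LieRingModule L M] [LieModule K L M]
  {B : LinearMap.BilinForm K I} (hB : B.Nondegenerate)

open Classical in
/-- The contraction `f ↦ ∑ i, f (b i) (c i)` of bilinear maps against a pair of dual bases `b`, `c`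
of a nondegenerate form. Evaluated on suitable `f` it gives the Casimir operator and the
primitive of a cocycle. -/
noncomputable def dualContraction : (I →ₗ[K] I →ₗ[K] M) →ₗ[K] M :=
  ∑ i, LinearMap.applyₗ (B.dualBasis hB (Module.finBasis K I) i) ∘ₗ
    LinearMap.applyₗ (Module.finBasis K I i)

open Classical in
theorem dualContraction_apply (f : I →ₗ[K] I →ₗ[K] M) :
    dualContraction hB f =
      ∑ i, f (Module.finBasis K I i) (B.dualBasis hB (Module.finBasis K I) i) := by
  simp [dualContraction]

theorem lie_dualContraction (hinv : B.lieInvariant L) (x : L) (f : I →ₗ[K] I →ₗ[K] M) :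
    ⁅x, dualContraction hB f⁆ = dualContraction hB ⁅x, f⁆ := by
  classical
  set b := Module.finBasis K I
  set c := B.dualBasis hB b with hc
  have expand_b (y : I) : y = ∑ j, B (c j) y • b j := by
    conv_lhs => rw [← b.sum_repr y]
    congr! with j
    simpa [LinearMap.BilinForm.flip_apply, hc] using
      LinearMap.BilinForm.dualBasis_repr_apply hB.flip c y j
  have expand_c (y : I) : y = ∑ j, B y (b j) • c j := by
    simpa only [hc, LinearMap.BilinForm.dualBasis_repr_apply] using (c.sum_repr y).symm
  have hb i : f ⁅x, b i⁆ (c i) = ∑ j, B (c j) ⁅x, b i⁆ • f (b j) (c i) := by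
    conv_lhs => rw [expand_b ⁅x, b i⁆]
    simp
  have hc i : f (b i) ⁅x, c i⁆ = ∑ j, B ⁅x, c i⁆ (b j) • f (b i) (c j) := by
    conv_lhs => rw [expand_c ⁅x, c i⁆]
    simp
  have cancel : ∑ i, f ⁅x, b i⁆ (c i) + ∑ i, f (b i) ⁅x, c i⁆ = 0 := by
    simp_rw [hb, hc]
    rw [Finset.sum_comm, ← Finset.sum_add_distrib]
    simp_rw [← Finset.sum_add_distrib, ← add_smul, hinv x (c _), add_neg_cancel, zero_smul,
      Finset.sum_const_zero]
  simp only [dualContraction_apply, lie_sum, LieHom.lie_apply, LinearMap.sub_apply,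
    Finset.sum_sub_distrib]
  rw [sub_sub, add_comm, cancel, sub_zero]

end DualContraction

section Casimir

open LieModule

variable {K L : Type*} [Field K] [LieRing L] [LieAlgebra K L]
  (J : LieIdeal K L) (M : Type*) [AddCommGroup M] [Module K M] [LieRingModule L M] [LieModule K L M]

/-- The trace form of `M` restricted to an ideal `J`. -/
noncomputable def restrictedTraceForm : LinearMap.BilinForm K J :=
  (traceForm K L M).domRestrict₁₂ J.toSubmodule J.toSubmodule

theorem restrictedTraceForm_apply (y z : J) :
    restrictedTraceForm J M y z = LinearMap.trace K M (toEnd K L M y ∘ₗ toEnd K L M z) := rfl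

theorem restrictedTraceForm_lieInvariant : (restrictedTraceForm J M).lieInvariant L :=
  fun x y z => traceForm_lieInvariant K L M x y z

theorem restrictedTraceForm_isSymm : (restrictedTraceForm J M).IsSymm :=
  ⟨fun y z => traceForm_comm K L M y z⟩

/-- The bilinear maps `(y, z) ↦ ⁅y, ⁅z, m⁆⁆` on an ideal, whose contraction is the Casimir operator
applied to `m`. -/
def lieLie : M →ₗ[K] J →ₗ[K] J →ₗ[K] M :=
  LinearMap.mk₂ K (fun m y => toEnd K L M y ∘ₗ
      (toEnd K L M : L →ₗ[K] Module.End K M).flip m ∘ₗ J.toSubmodule.subtype)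
    (fun _ _ _ => by ext; simp) (fun _ _ _ => by ext; simp)
    (fun _ _ _ => by ext; simp) (fun _ _ _ => by ext; simp)

variable {M}

theorem lieLie_apply (m : M) (y z : J) : lieLie J M m y z = ⁅(y : L), ⁅(z : L), m⁆⁆ := rfl

theorem lie_lieLie (x : L) (m : M) : ⁅x, lieLie J M m⁆ = lieLie J M ⁅x, m⁆ := by
  ext y z
  simp only [LieHom.lie_apply, LinearMap.sub_apply, lieLie_apply, LieSubmodule.coe_bracket,
    lie_lie x (y : L), lie_lie x (z : L), lie_sub]
  abel

variable {J} [Module.Finite K L] (hJ : (restrictedTraceForm J M).Nondegenerate)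

/-- The Casimir operator of `M` attached to an ideal on which the trace form of `M` is
nondegenerate. -/
noncomputable def casimir : M →ₗ⁅K,L⁆ M where
  __ := dualContraction hJ ∘ₗ lieLie J M
  map_lie' {x m} := by
    change dualContraction hJ (lieLie J M ⁅x, m⁆) = ⁅x, dualContraction hJ (lieLie J M m)⁆
    rw [lie_dualContraction hJ (restrictedTraceForm_lieInvariant J M), lie_lieLie]

theorem casimir_apply (m : M) : casimir hJ m = dualContraction hJ (lieLie J M m) := rfl

theorem trace_casimir : LinearMap.trace K M (casimir hJ : M →ₗ[K] M) = Module.finrank K J := by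
  classical
  set b := Module.finBasis K J
  set c := (restrictedTraceForm J M).dualBasis hJ b
  have hcasimir : (casimir hJ : M →ₗ[K] M) = ∑ i, toEnd K L M (b i) ∘ₗ toEnd K L M (c i) := by
    ext m
    simp [casimir_apply, dualContraction_apply, lieLie_apply, b, c]
  have hdual i : restrictedTraceForm J M (b i) (c i) = 1 := by
    simp [c, LinearMap.BilinForm.apply_dualBasis_right hJ (restrictedTraceForm_isSymm J M)]
  simp_rw [hcasimir, map_sum, ← restrictedTraceForm_apply, hdual]
  simp

theorem exists_lie_eq_casimir (D : LieDerivation K L M) : ∃ m, ∀ x, ⁅x, m⁆ = casimir hJ (D x) := by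
  let f : J →ₗ[K] J →ₗ[K] M := LinearMap.mk₂ K (fun y z => ⁅(y : L), D z⁆)
    (by simp) (by simp) (by simp) (by simp)
  have hf (x : L) : ⁅x, f⁆ = lieLie J M (D x) := by
    ext y z
    simp only [f, LieHom.lie_apply, LinearMap.sub_apply, LinearMap.mk₂_apply, lieLie_apply,
      LieSubmodule.coe_bracket, LieDerivation.apply_lie_eq_sub, lie_lie x (y : L), lie_sub]
    abel
  refine ⟨dualContraction hJ f, fun x => ?_⟩
  rw [lie_dualContraction hJ (restrictedTraceForm_lieInvariant J M), hf, casimir_apply]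

theorem casimir_bijective [CharZero K] [Module.Finite K M] [IsIrreducible K L M] (hJ₀ : J ≠ ⊥) :
    Function.Bijective (casimir hJ) := by
  have hne : (casimir hJ).ker ≠ ⊤ := by
    intro htop
    have hzero : (casimir hJ : M →ₗ[K] M) = 0 :=
      LinearMap.ext fun m => (casimir hJ).mem_ker.1 (htop ▸ LieSubmodule.mem_top m)
    have hfinrank : Module.finrank K J = 0 := by
      simpa [hzero, eq_comm] using trace_casimir hJ
    have := (LieSubmodule.nontrivial_iff_ne_bot K L L).2 hJ₀
    exact Module.finrank_pos.ne' hfinrank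
  have hinj : Function.Injective (casimir hJ) :=
    (casimir hJ).ker_eq_bot.1 ((eq_bot_or_eq_top _).resolve_right hne)
  exact ⟨hinj, LinearMap.injective_iff_surjective.1 hinj⟩

end Casimir

section Whitehead

open LieModule

variable {K L M : Type*} [Field K] [LieRing L] [LieAlgebra K L]
  [LieAlgebra.IsSemisimple K L] [AddCommGroup M] [Module K M]
  [LieRingModule L M] [LieModule K L M]

theorem isTrivial_of_traceForm_eq_zero [CharZero K] [Module.Finite K M] [IsIrreducible K L M]
    (h : traceForm K L M = 0) : IsTrivial L M := by
  have hnil : LieModule.IsNilpotent L M := by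
    have hderived := isNilpotent_derivedSeries_of_traceForm_eq_zero h
    rw [isNilpotent_iff_forall' (R := K)] at hderived ⊢
    refine fun x => hderived ⟨x, ?_⟩
    rw [LieAlgebra.derivedSeries_def, LieAlgebra.derivedSeriesOfIdeal_succ,
      LieAlgebra.derivedSeriesOfIdeal_zero, lie_top_top_of_isSemisimple]
    exact LieSubmodule.mem_top x
  have := nontrivial_of_isIrreducible K L M
  have := nontrivial_max_triv_of_isNilpotent K L M
  exact isTrivial_iff_max_triv_eq_top K L M |>.2
    ((maxTrivSubmodule K L M).eq_top_of_isIrreducible K L M)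

variable (K L M) in
theorem exists_restrictedTraceForm_nondegenerate (h : traceForm K L M ≠ 0) :
    ∃ J : LieIdeal K L, J ≠ ⊥ ∧ (restrictedTraceForm J M).Nondegenerate := by
  let I : LieIdeal K L :=
    { LinearMap.ker (traceForm K L M) with
      lie_mem := fun {x y} hy => LinearMap.ext fun z => by
        have hy : traceForm K L M y = 0 := hy
        simp [traceForm_lieInvariant K L M x y z, hy] }
  obtain ⟨J, hJ⟩ := exists_isCompl I
  refine ⟨J, ?_, traceForm_isSymm K L M |>.nondegenerate_restrict_of_isCompl_ker
    (LieSubmodule.isCompl_toSubmodule.2 hJ.symm)⟩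
  rintro rfl
  have htop : I = ⊤ := by simpa using hJ.sup_eq_top
  exact h (LinearMap.ker_eq_top.1 (congrArg LieSubmodule.toSubmodule htop))

theorem exists_inner_eq_of_isIrreducible [CharZero K] [Module.Finite K L] [Module.Finite K M]
    [IsIrreducible K L M] (D : LieDerivation K L M) : ∃ m, LieDerivation.inner K L M m = D := by
  by_cases h : traceForm K L M = 0
  · have := isTrivial_of_traceForm_eq_zero h
    have hker : LinearMap.ker (D : L →ₗ[K] M) = ⊤ := eq_top_of_forall_lie_mem fun x y => by
      simp [trivial_lie_zero]
    exact ⟨0, LieDerivation.ext fun x => by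
      simpa using (LinearMap.congr_fun (LinearMap.ker_eq_top.1 hker) x).symm⟩
  · obtain ⟨J, hJ₀, hJ⟩ := exists_restrictedTraceForm_nondegenerate K L M h
    have hbij := casimir_bijective hJ hJ₀
    obtain ⟨m₀, hm₀⟩ := exists_lie_eq_casimir hJ D
    obtain ⟨m, rfl⟩ := hbij.surjective m₀
    refine ⟨m, LieDerivation.ext fun x => hbij.injective ?_⟩
    simp [← hm₀]

/-- **Whitehead's first lemma**. -/
theorem exists_inner_eq [CharZero K] [Module.Finite K L] [Module.Finite K M]
    (D : LieDerivation K L M) : ∃ m, LieDerivation.inner K L M m = D := by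
  induction hn : Module.finrank K M using Nat.strong_induction_on generalizing M with
  | _ n ih =>
  rcases subsingleton_or_nontrivial M with hM | hM
  · exact ⟨0, LieDerivation.ext fun x => Subsingleton.elim _ _⟩
  by_cases hirr : ∀ N : LieSubmodule K L M, N ≠ ⊥ → N = ⊤
  · have := IsIrreducible.mk hirr
    exact exists_inner_eq_of_isIrreducible D
  push Not at hirr
  obtain ⟨N, hN_bot, hN_top⟩ := hirr
  have hN_pos : 0 < Module.finrank K N :=
    Module.finrank_pos_iff.2 ((LieSubmodule.nontrivial_iff_ne_bot K L M).2 hN_bot)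
  have hN_lt : Module.finrank K N < n := hn ▸ Submodule.finrank_lt
    (mt N.toSubmodule_eq_top.1 hN_top)
  have hfinrank : Module.finrank K (M ⧸ N) + Module.finrank K N = Module.finrank K M :=
    Submodule.finrank_quotient_add_finrank N.toSubmodule
  let π := LieSubmodule.Quotient.mk' N
  let Dquot : LieDerivation K L (M ⧸ N) :=
    { (π : M →ₗ[K] M ⧸ N) ∘ₗ (D : L →ₗ[K] M) with
      leibniz' := fun x y => by simp [← LieModuleHom.map_lie] }
  obtain ⟨q, hq⟩ := ih _ (by omega) Dquot rfl
  obtain ⟨m, rfl⟩ := LieSubmodule.Quotient.surjective_mk' N q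
  let D' : LieDerivation K L M := D - LieDerivation.inner K L M m
  have hmem (x : L) : D' x ∈ N := by
    have hx : ⁅x, π m⁆ = π (D x) := DFunLike.congr_fun hq x
    have hzero : π (D x - ⁅x, m⁆) = 0 := by rw [map_sub, LieModuleHom.map_lie, hx, sub_self]
    exact (LieSubmodule.Quotient.mk_eq_zero N).1 hzero
  let Dsub : LieDerivation K L N :=
    { (D' : L →ₗ[K] M).codRestrict N.toSubmodule hmem with
      leibniz' := fun x y => Subtype.ext (LieDerivation.apply_lie_eq_sub _ x y) }
  obtain ⟨m', hm'⟩ := ih _ hN_lt Dsub rfl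
  refine ⟨m + m', ?_⟩
  rw [map_add, ← eq_sub_iff_add_eq']
  exact LieDerivation.ext fun x => congrArg Subtype.val (DFunLike.congr_fun hm' x)

theorem exists_mem_forall_sub_lie_mem [CharZero K] [Module.Finite K L]
    (P J : LieSubmodule K L M) [Module.Finite K P] {d : L →ₗ[K] M} (hdP : ∀ x, d x ∈ P)
    (hd : ∀ x y, d ⁅x, y⁆ - (⁅x, d y⁆ - ⁅y, d x⁆) ∈ J) : ∃ m ∈ P, ∀ x, d x - ⁅x, m⁆ ∈ J := by
  let Q : LieSubmodule K L P := J.comap P.incl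
  let π := LieSubmodule.Quotient.mk' Q
  have hπ (p : P) : π p = 0 ↔ (p : M) ∈ J := LieSubmodule.Quotient.mk_eq_zero Q
  let e : L →ₗ[K] P := d.codRestrict P.toSubmodule hdP
  let D : LieDerivation K L (P ⧸ Q) :=
    { (π : P →ₗ[K] P ⧸ Q) ∘ₗ e with
      leibniz' := fun x y => by
        have hxy : π (e ⁅x, y⁆ - (⁅x, e y⁆ - ⁅y, e x⁆)) = 0 := (hπ _).2 (hd x y)
        simpa only [map_sub, sub_eq_zero, LieModuleHom.map_lie] using! hxy }
  obtain ⟨q, hq⟩ := exists_inner_eq D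
  obtain ⟨m, rfl⟩ := LieSubmodule.Quotient.surjective_mk' Q q
  refine ⟨m, m.2, fun x => ?_⟩
  have hx : ⁅x, π m⁆ = π (e x) := DFunLike.congr_fun hq x
  exact (hπ (e x - ⁅x, m⁆)).1 (by rw [map_sub, LieModuleHom.map_lie, hx, sub_self])

end Whitehead

/-! ### Left Leibniz algebras and Levi subalgebras -/

namespace LeibnizAlg

variable {L : Type*} [AddCommGroup L] [Module ℂ L] {β : L →ₗ[ℂ] L →ₗ[ℂ] L}

section Semisimple

variable (hβ : IsLeftLeibniz β) {S : Submodule ℂ L} (hS : IsSubalgebra β S)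
  (halt : ∀ a ∈ S, β a a = 0)

/-- The left action of a Lie subalgebra `S` on the ambient Leibniz algebra. -/
abbrev lieRingModule : @LieRingModule S L (lieRing hβ hS halt) _ :=
  letI := lieRing hβ hS halt
  { bracket := fun s x => β s x
    add_lie := fun _ _ _ => by simp
    lie_add := fun s x y => map_add _ x y
    leibniz_lie := fun s t => hβ s t }

/-- The left action of a Lie subalgebra `S` on the ambient Leibniz algebra is linear. -/
abbrev lieModule : @LieModule ℂ S L _ (lieRing hβ hS halt) (lieAlgebra hβ hS halt) _ _
    (lieRingModule hβ hS halt) :=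
  letI := lieRing hβ hS halt
  letI := lieAlgebra hβ hS halt
  letI := lieRingModule hβ hS halt
  { smul_lie := fun c s => LinearMap.map_smul₂ β c (s : L)
    lie_smul := fun c _ x => map_smul _ c x }

variable (hss : @LieAlgebra.IsSemisimple ℂ S _ (lieRing hβ hS halt) (lieAlgebra hβ hS halt))

include hss in
theorem map₂_self_of_isSemisimple : Submodule.map₂ β S S = S := by
  let := lieRing hβ hS halt
  let := lieAlgebra hβ hS halt
  refine le_antisymm (Submodule.map₂_le.2 hS) ?_
  have htop : (Submodule.map₂ β S S).comap S.subtype = ⊤ :=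
    eq_top_of_forall_lie_mem fun s t => Submodule.apply_mem_map₂ _ s.2 t.2
  rwa [Submodule.comap_subtype_eq_top] at htop

include hss in
theorem exists_mem_forall_sub_mem_of_cocycle [FiniteDimensional ℂ S] {J P : Submodule ℂ L}
    [FiniteDimensional ℂ P] (hJ : ∀ s ∈ S, ∀ x ∈ J, β s x ∈ J) (hP : ∀ s ∈ S, ∀ x ∈ P, β s x ∈ P)
    {d : L →ₗ[ℂ] L} (hdP : ∀ s ∈ S, d s ∈ P)
    (hd : ∀ s ∈ S, ∀ t ∈ S, d (β s t) - (β s (d t) - β t (d s)) ∈ J) :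
    ∃ m ∈ P, ∀ s ∈ S, d s - β s m ∈ J := by
  let := lieRing hβ hS halt
  let := lieAlgebra hβ hS halt
  let := lieRingModule hβ hS halt
  have := lieModule hβ hS halt
  let P' : LieSubmodule ℂ S L := { P with lie_mem := fun {s x} hx => hP s s.2 x hx }
  let J' : LieSubmodule ℂ S L := { J with lie_mem := fun {s x} hx => hJ s s.2 x hx }
  have : Module.Finite ℂ P' := ‹FiniteDimensional ℂ P›
  obtain ⟨m, hm, hdm⟩ := exists_mem_forall_sub_lie_mem P' J' (d := d ∘ₗ S.subtype)
    (fun s => hdP s s.2) (fun s t => hd s s.2 t t.2)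
  exact ⟨m, hm, fun s hs => hdm ⟨s, hs⟩⟩

end Semisimple

section Ideal

variable {A I J : Submodule ℂ L}

theorem IsIdealOf.isSubalgebra (h : IsIdealOf β A I) : IsSubalgebra β I :=
  fun a ha b hb => (h.2 a (h.1 ha) b hb).1

theorem derivedSeries_mono (h : I ≤ J) (k : ℕ) : derivedSeries β I k ≤ derivedSeries β J k := by
  induction k with
  | zero => exact h
  | succ k ih => exact Submodule.map₂_le_map₂ ih ih

theorem IsSubalgebra.derivedSeries_le (h : IsSubalgebra β A) (k : ℕ) : derivedSeries β A k ≤ A := by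
  induction k with
  | zero => exact le_rfl
  | succ k ih => exact (Submodule.map₂_le_map₂ ih ih).trans (Submodule.map₂_le.2 h)

theorem derivedSeries_add (k l : ℕ) :
    derivedSeries β A (k + l) = derivedSeries β (derivedSeries β A k) l := by
  induction l with
  | zero => rfl
  | succ l ih => rw [← add_assoc, derivedSeries, derivedSeries, ih]

theorem IsIdealOf.map₂ (hβ : IsLeftLeibniz β) (h : IsIdealOf β A I) :
    IsIdealOf β A (Submodule.map₂ β I I) := by
  refine ⟨(Submodule.map₂_le.2 h.isSubalgebra).trans h.1, fun a ha => ?_⟩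
  suffices Submodule.map₂ β I I ≤ (Submodule.map₂ β I I).comap (β a) ⊓
      (Submodule.map₂ β I I).comap (β.flip a) from
    fun x hx => ⟨(this hx).1, (this hx).2⟩
  refine Submodule.map₂_le.2 fun x hx y hy => ⟨?_, ?_⟩
  · change β a (β x y) ∈ Submodule.map₂ β I I
    rw [hβ]
    exact Submodule.add_mem _ (Submodule.apply_mem_map₂ _ (h.2 a ha x hx).1 hy)
      (Submodule.apply_mem_map₂ _ hx (h.2 a ha y hy).1)
  · change β (β x y) a ∈ Submodule.map₂ β I I
    rw [eq_sub_of_add_eq (hβ x y a).symm]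
    exact Submodule.sub_mem _ (Submodule.apply_mem_map₂ _ hx (h.2 a ha y hy).2)
      (Submodule.apply_mem_map₂ _ hy (h.2 a ha x hx).2)

theorem IsIdealOf.derivedSeries (hβ : IsLeftLeibniz β) (h : IsIdealOf β A I) (k : ℕ) :
    IsIdealOf β A (derivedSeries β I k) := by
  induction k with
  | zero => exact h
  | succ k ih => exact ih.map₂ hβ

theorem isIdealOf_bot : IsIdealOf β A ⊥ :=
  ⟨bot_le, fun a _ x hx => by simp [(Submodule.mem_bot ℂ).1 hx]⟩

theorem isIdealOf_sSup {s : Set (Submodule ℂ L)} (hs : ∀ I ∈ s, IsIdealOf β A I) :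
    IsIdealOf β A (sSup s) := by
  refine ⟨sSup_le fun I hI => (hs I hI).1, fun a ha => ?_⟩
  suffices sSup s ≤ (sSup s).comap (β a) ⊓ (sSup s).comap (β.flip a) from fun x hx => this hx
  exact sSup_le fun I hI x hx => ⟨le_sSup hI ((hs I hI).2 a ha x hx).1,
    le_sSup hI ((hs I hI).2 a ha x hx).2⟩

theorem IsIdealOf.sup (hI : IsIdealOf β A I) (hJ : IsIdealOf β A J) : IsIdealOf β A (I ⊔ J) := by
  rw [← sSup_pair]
  refine isIdealOf_sSup ?_
  rintro K (rfl | rfl)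
  exacts [hI, hJ]

theorem IsIdealOf.map₂_sup_le (hJ : IsIdealOf β A J) (hI : I ≤ A) :
    Submodule.map₂ β (I ⊔ J) (I ⊔ J) ≤ Submodule.map₂ β I I ⊔ J := by
  rw [Submodule.map₂_sup_left, Submodule.map₂_sup_right]
  exact sup_le (sup_le_sup_left (Submodule.map₂_le.2 fun x hx y hy => (hJ.2 x (hI hx) y hy).1) _)
    (le_sup_of_le_right <| Submodule.map₂_le.2 fun x hx y hy =>
      (hJ.2 y (sup_le hI hJ.1 hy) x hx).2)

theorem derivedSeries_sup_le (hIA : I ≤ A) (hI : IsSubalgebra β I) (hJ : IsIdealOf β A J) (k : ℕ) :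
    derivedSeries β (I ⊔ J) k ≤ derivedSeries β I k ⊔ J := by
  induction k with
  | zero => exact le_rfl
  | succ k ih =>
    exact (Submodule.map₂_le_map₂ ih ih).trans
      (hJ.map₂_sup_le ((hI.derivedSeries_le k).trans hIA))

theorem IsSolvable.mono (h : I ≤ J) (hJ : IsSolvable β J) : IsSolvable β I := by
  obtain ⟨k, hk⟩ := hJ
  exact ⟨k, le_bot_iff.1 ((derivedSeries_mono h k).trans hk.le)⟩

theorem IsSolvable.sup (hIA : I ≤ A) (hI : IsSubalgebra β I) (hJ : IsIdealOf β A J)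
    (hsI : IsSolvable β I) (hsJ : IsSolvable β J) : IsSolvable β (I ⊔ J) := by
  obtain ⟨k, hk⟩ := hsI
  obtain ⟨l, hl⟩ := hsJ
  refine ⟨k + l, le_bot_iff.1 ?_⟩
  rw [derivedSeries_add, ← hl]
  refine derivedSeries_mono ((derivedSeries_sup_le hIA hI hJ k).trans ?_) l
  rw [hk, bot_sup_eq]

theorem isIdealOf_solvableRadical : IsIdealOf β A (solvableRadical β A) :=
  isIdealOf_sSup fun _ h => h.1

theorem le_solvableRadical (hI : IsIdealOf β A I) (hs : IsSolvable β I) :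
    I ≤ solvableRadical β A := le_sSup ⟨hI, hs⟩

theorem isSolvable_solvableRadical [FiniteDimensional ℂ A] :
    IsSolvable β (solvableRadical β A) := by
  have hfg : (solvableRadical β A).FG := Module.Finite.iff_fg.1
    (Submodule.finiteDimensional_of_le isIdealOf_solvableRadical.1)
  obtain ⟨I, hI, hle⟩ := CompleteLattice.isCompactElement_iff_le_of_directed_sSup_le _ _ |>.1
    ((Submodule.fg_iff_compact _).1 hfg) {I | IsIdealOf β A I ∧ IsSolvable β I}
    ⟨⊥, isIdealOf_bot, 0, rfl⟩
    (fun I hI J hJ => ⟨I ⊔ J, ⟨hI.1.sup hJ.1, .sup hI.1.1 hI.1.isSubalgebra hJ.1 hI.2 hJ.2⟩,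
      le_sup_left, le_sup_right⟩) le_rfl
  exact hI.2.mono hle

end Ideal

section Map

variable {L' : Type*} [AddCommGroup L'] [Module ℂ L'] {β' : L' →ₗ[ℂ] L' →ₗ[ℂ] L'}

section LinearMap

variable {f : L →ₗ[ℂ] L'} (hf : ∀ a b, f (β a b) = β' (f a) (f b)) {A I : Submodule ℂ L}

include hf

theorem map_map₂ (I J : Submodule ℂ L) :
    (Submodule.map₂ β I J).map f = Submodule.map₂ β' (I.map f) (J.map f) := by
  rw [Submodule.map_map₂, Submodule.map₂_map_map]
  congr 1
  ext a b
  exact hf a b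

theorem map_derivedSeries (I : Submodule ℂ L) (k : ℕ) :
    (derivedSeries β I k).map f = derivedSeries β' (I.map f) k := by
  induction k with
  | zero => rfl
  | succ k ih => rw [derivedSeries, derivedSeries, map_map₂ hf, ih]

theorem IsSubalgebra.map (h : IsSubalgebra β A) : IsSubalgebra β' (A.map f) := by
  rintro _ ⟨a, ha, rfl⟩ _ ⟨b, hb, rfl⟩
  exact ⟨β a b, h a ha b hb, hf a b⟩

theorem IsIdealOf.map (h : IsIdealOf β A I) : IsIdealOf β' (A.map f) (I.map f) := by
  refine ⟨Submodule.map_mono h.1, ?_⟩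
  rintro _ ⟨a, ha, rfl⟩ _ ⟨x, hx, rfl⟩
  exact ⟨⟨β a x, (h.2 a ha x hx).1, hf a x⟩, ⟨β x a, (h.2 a ha x hx).2, hf x a⟩⟩

theorem IsSolvable.map (h : IsSolvable β A) : IsSolvable β' (A.map f) := by
  obtain ⟨k, hk⟩ := h
  exact ⟨k, by rw [← map_derivedSeries hf, hk, Submodule.map_bot]⟩

theorem map_solvableRadical_le (A : Submodule ℂ L) :
    (solvableRadical β A).map f ≤ solvableRadical β' (A.map f) := by
  rw [Submodule.map_le_iff_le_comap]
  exact sSup_le fun I hI => Submodule.map_le_iff_le_comap.1 <|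
    le_solvableRadical (hI.1.map hf) (hI.2.map hf)

end LinearMap

variable {g : L ≃ₗ[ℂ] L'} (hg : ∀ a b, g (β a b) = β' (g a) (g b))

include hg

theorem map_solvableRadical (A : Submodule ℂ L) :
    (solvableRadical β A).map (g : L →ₗ[ℂ] L') = solvableRadical β' (A.map (g : L →ₗ[ℂ] L')) := by
  have hg_symm : ∀ a b, g.symm (β' a b) = β (g.symm a) (g.symm b) := fun a b =>
    g.injective (by simp [hg])
  refine le_antisymm (map_solvableRadical_le hg A) ?_
  have h := map_solvableRadical_le (f := g.symm.toLinearMap) hg_symm (A.map g.toLinearMap)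
  rwa [Submodule.map_equiv_eq_comap_symm g A, Submodule.map_comap_eq_of_surjective
    g.symm.surjective, ← Submodule.map_equiv_eq_comap_symm, Submodule.map_le_iff_le_comap,
    ← Submodule.map_equiv_eq_comap_symm] at h

theorem IsLeviSubalgebra.map {hβ : IsLeftLeibniz β} {hβ' : IsLeftLeibniz β'} {A S : Submodule ℂ L}
    [FiniteDimensional ℂ S] (h : IsLeviSubalgebra hβ A S) :
    IsLeviSubalgebra hβ' (A.map (g : L →ₗ[ℂ] L')) (S.map (g : L →ₗ[ℂ] L')) := by
  have hsub : IsSubalgebra β' (S.map (g : L →ₗ[ℂ] L')) := h.isSubalgebra.map hg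
  have halt : ∀ a ∈ S.map (g : L →ₗ[ℂ] L'), β' a a = 0 := by
    rintro _ ⟨a, ha, rfl⟩
    exact (hg a a).symm.trans (by rw [h.alternating a ha, map_zero])
  refine ⟨hsub, halt, ?_, ?_, ?_⟩
  · let := lieRing hβ h.isSubalgebra h.alternating
    let := lieAlgebra hβ h.isSubalgebra h.alternating
    let := lieRing hβ' hsub halt
    let := lieAlgebra hβ' hsub halt
    have := h.isSemisimple
    let e : S ≃ₗ⁅ℂ⁆ S.map (g : L →ₗ[ℂ] L') :=
      { g.submoduleMap S with map_lie' := fun {a b} => Subtype.ext (hg a b) }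
    have : LieAlgebra.IsKilling ℂ (S.map (g : L →ₗ[ℂ] L')) := LieAlgebra.isKilling_of_equiv e
    infer_instance
  · rw [← map_solvableRadical hg, ← Submodule.map_inf _ g.injective, h.inf_eq, Submodule.map_bot]
  · rw [← map_solvableRadical hg, ← Submodule.map_sup, h.sup_eq]

end Map

section Malcev

variable {A I J S T : Submodule ℂ L}

theorem exists_eq_zero_and_eq_self_of_disjoint (h : Disjoint T I) :
    ∃ p : L →ₗ[ℂ] L, (∀ t ∈ T, p t = 0) ∧ ∀ x ∈ I, p x = x := by
  obtain ⟨C, hTC, hIC⟩ := h.exists_isCompl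
  exact ⟨I.projection C hIC.symm, fun t ht => (Submodule.projection_apply_eq_zero_iff _).2 (hTC ht),
    fun x hx => Submodule.projection_apply_of_mem_left _ hx⟩

section Projection

variable {p : L →ₗ[ℂ] L} (hpT : ∀ t ∈ T, p t = 0) (hpI : ∀ x ∈ I, p x = x)

include hpT hpI

theorem apply_mem_and_sub_apply_mem {x : L} (hx : x ∈ T ⊔ I) : p x ∈ I ∧ x - p x ∈ T := by
  obtain ⟨t, ht, i, hi, rfl⟩ := Submodule.mem_sup.1 hx
  rw [map_add, hpT t ht, hpI i hi, zero_add, add_sub_cancel_right]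
  exact ⟨hi, ht⟩

theorem projection_bracket_sub_mem (hT : IsSubalgebra β T) (hTA : T ≤ A) (hI : IsIdealOf β A I)
    (hII : Submodule.map₂ β I I ≤ J) (hsymm : ∀ a ∈ A, ∀ b ∈ A, β a b + β b a ∈ J) {x y : L}
    (hx : x ∈ T ⊔ I) (hy : y ∈ T ⊔ I) : p (β x y) - (β x (p y) - β y (p x)) ∈ J := by
  obtain ⟨s, hs, d, hd, rfl⟩ := Submodule.mem_sup.1 hx
  obtain ⟨t, ht, e, he, rfl⟩ := Submodule.mem_sup.1 hy
  have hp_bracket : p (β (s + d) (t + e)) = β s e + β d t + β d e := by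
    simp only [map_add, LinearMap.add_apply, hpT _ (hT s hs t ht), hpI _ (hI.2 s (hTA hs) e he).1,
      hpI _ (hI.2 t (hTA ht) d hd).2, hpI _ (hI.2 e (hI.1 he) d hd).2]
    abel
  have hdefect : p (β (s + d) (t + e)) - (β (s + d) (p (t + e)) - β (t + e) (p (s + d))) =
      (β d t + β t d) + β e d := by
    rw [hp_bracket]
    simp only [map_add, LinearMap.add_apply, hpT s hs, hpT t ht, hpI d hd, hpI e he,
      map_zero]
    abel
  rw [hdefect]
  exact J.add_mem (hsymm d (hI.1 hd) t (hTA ht)) (hII (Submodule.apply_mem_map₂ _ he hd))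

end Projection

theorem exists_add_bracket_mem_sup [FiniteDimensional ℂ A] (hβ : IsLeftLeibniz β)
    (hS : IsSubalgebra β S) (halt : ∀ a ∈ S, β a a = 0)
    (hss : @LieAlgebra.IsSemisimple ℂ S _ (lieRing hβ hS halt) (lieAlgebra hβ hS halt))
    (hT : IsSubalgebra β T) (hTA : T ≤ A) (hTI : Disjoint T I) (hI : IsIdealOf β A I)
    (hJ : IsIdealOf β A J) (hII : Submodule.map₂ β I I ≤ J)
    (hsymm : ∀ a ∈ A, ∀ b ∈ A, β a b + β b a ∈ J) (hle : S ≤ T ⊔ I) :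
    ∃ a ∈ Submodule.map₂ β S I, ∀ s ∈ S, s + β a s ∈ T ⊔ J := by
  have hSA : S ≤ A := hle.trans (sup_le hTA hI.1)
  have := Submodule.finiteDimensional_of_le hSA
  obtain ⟨p, hpT, hpI⟩ := exists_eq_zero_and_eq_self_of_disjoint hTI
  have hdec : ∀ s ∈ S, p s ∈ I ∧ s - p s ∈ T := fun s hs =>
    apply_mem_and_sub_apply_mem hpT hpI (hle hs)
  have hcocycle : ∀ s ∈ S, ∀ t ∈ S, p (β s t) - (β s (p t) - β t (p s)) ∈ J := fun s hs t ht =>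
    projection_bracket_sub_mem hpT hpI hT hTA hI hII hsymm (hle hs) (hle ht)
  set P := Submodule.map₂ β S I ⊔ J
  have hSI : Submodule.map₂ β S I ≤ I :=
    Submodule.map₂_le.2 fun s hs x hx => (hI.2 s (hSA hs) x hx).1
  have hIP : ∀ s ∈ S, ∀ x ∈ I, β s x ∈ P := fun s hs x hx =>
    Submodule.mem_sup_left (Submodule.apply_mem_map₂ _ hs hx)
  have hJinv : ∀ s ∈ S, ∀ x ∈ J, β s x ∈ J := fun s hs x hx => (hJ.2 s (hSA hs) x hx).1
  have hPinv : ∀ s ∈ S, ∀ x ∈ P, β s x ∈ P := fun s hs => show P ≤ P.comap (β s) from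
    sup_le (fun x hx => hIP s hs x (hSI hx)) fun x hx => Submodule.mem_sup_right (hJinv s hs x hx)
  -- As `S = [S, S]`, the cocycle `p` takes values in `[S, I] + J`.
  have hpP : ∀ s ∈ S, p s ∈ P := by
    suffices Submodule.map₂ β S S ≤ P.comap p by
      rwa [map₂_self_of_isSemisimple hβ hS halt hss] at this
    refine Submodule.map₂_le.2 fun s hs t ht => ?_
    rw [Submodule.mem_comap, ← sub_add_cancel (p (β s t)) (β s (p t) - β t (p s))]
    exact P.add_mem (Submodule.mem_sup_right (hcocycle s hs t ht))
      (P.sub_mem (hIP s hs _ (hdec t ht).1) (hIP t ht _ (hdec s hs).1))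
  have := Submodule.finiteDimensional_of_le (show P ≤ A from sup_le (hSI.trans hI.1) hJ.1)
  obtain ⟨m, hm, hpm⟩ :=
    exists_mem_forall_sub_mem_of_cocycle hβ hS halt hss hJinv hPinv hpP hcocycle
  obtain ⟨a, ha, j, hj, rfl⟩ := Submodule.mem_sup.1 hm
  refine ⟨a, ha, fun s hs => ?_⟩
  have hsplit : s + β a s =
      (s - p s) + ((p s - β s (a + j)) + β s j + (β a s + β s a)) := by
    rw [map_add]
    abel
  rw [hsplit]
  exact Submodule.add_mem_sup (hdec s hs).2 (J.add_mem (J.add_mem (hpm s hs) (hJinv s hs j hj))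
    (hsymm a (hI.1 (hSI ha)) s (hSA hs)))

end Malcev

section Levi

variable {hβ : IsLeftLeibniz β} {A N S S₁ S₂ : Submodule ℂ L}

theorem IsLeviSubalgebra.le (h : IsLeviSubalgebra hβ A S) : S ≤ A :=
  le_sup_left.trans_eq h.sup_eq

theorem IsLeviSubalgebra.map₂_self (h : IsLeviSubalgebra hβ A S) : Submodule.map₂ β S S = S :=
  map₂_self_of_isSemisimple hβ h.isSubalgebra h.alternating h.isSemisimple

theorem IsLeviSubalgebra.eq_of_le (h₁ : IsLeviSubalgebra hβ A S₁) (h₂ : IsLeviSubalgebra hβ A S₂)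
    (h : S₁ ≤ S₂) : S₁ = S₂ :=
  eq_of_le_of_inf_le_of_sup_le h (h₂.inf_eq.trans_le bot_le)
    ((sup_le h₂.le isIdealOf_solvableRadical.1).trans h₁.sup_eq.ge)

theorem IsLeviSubalgebra.le_of_le_sup_of_central (h₁ : IsLeviSubalgebra hβ A S₁)
    (h₂ : IsLeviSubalgebra hβ A S₂) (hN : N ≤ A)
    (hcentral : ∀ a ∈ A, ∀ x ∈ N, β a x = 0 ∧ β x a = 0) (hle : S₁ ≤ S₂ ⊔ N) : S₁ ≤ S₂ := by
  rw [← h₁.map₂_self]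
  refine Submodule.map₂_le.2 fun x hx y hy => ?_
  obtain ⟨s, hs, m, hm, rfl⟩ := Submodule.mem_sup.1 (hle hx)
  obtain ⟨t, ht, n, hn, rfl⟩ := Submodule.mem_sup.1 (hle hy)
  rw [map_add β, LinearMap.add_apply, (hcentral _ (A.add_mem (h₂.le ht) (hN hn)) m hm).2, map_add,
    (hcentral s (h₂.le hs) n hn).1, add_zero, add_zero]
  exact h₂.isSubalgebra s hs t ht

end Levi

end LeibnizAlg

/-! ### Exponentials of endomorphisms -/

section Exponential

open Module
open scoped Nat

variable {𝕜 : Type*} [RCLike 𝕜]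
variable {W : Type*} [AddCommGroup W] [Module 𝕜 W] [FiniteDimensional 𝕜 W]
variable {W' : Type*} [AddCommGroup W'] [Module 𝕜 W'] [FiniteDimensional 𝕜 W']
variable {W'' : Type*} [AddCommGroup W''] [Module 𝕜 W''] [FiniteDimensional 𝕜 W'']

/-- The exponential of an endomorphism of a finite-dimensional vector space. It is computed on
matrices because `Module.End 𝕜 W` carries no topology; see `hasSum_endExp`. -/
noncomputable def endExp (T : End 𝕜 W) : End 𝕜 W :=
  Matrix.toLinAlgEquiv (finBasis 𝕜 W)
    (NormedSpace.exp (LinearMap.toMatrixAlgEquiv (finBasis 𝕜 W) T))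

open scoped Matrix.Norms.Operator in
theorem hasSum_endExp (T : End 𝕜 W) (w : W) (f : Dual 𝕜 W) :
    HasSum (fun n : ℕ => (n ! : 𝕜)⁻¹ * f ((T ^ n) w)) (f (endExp T w)) := by
  let b := finBasis 𝕜 W
  let evalMatrix : Matrix (Fin (finrank 𝕜 W)) (Fin (finrank 𝕜 W)) 𝕜 →ₗ[𝕜] 𝕜 :=
    f ∘ₗ LinearMap.applyₗ w ∘ₗ (Matrix.toLinAlgEquiv b).toLinearMap
  have hsum := (NormedSpace.exp_series_hasSum_exp' (𝕂 := 𝕜) (LinearMap.toMatrixAlgEquiv b T)).map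
    evalMatrix (LinearMap.continuous_of_finiteDimensional evalMatrix)
  convert hsum using 2 with n
  · simp [evalMatrix, ← map_pow]
  · rfl

theorem endExp_add {T T' : End 𝕜 W} (h : Commute T T') :
    endExp (T + T') = endExp T * endExp T' := by
  rw [endExp, map_add, Matrix.exp_add_of_commute _ _ (h.map _), map_mul, endExp, endExp]

theorem apply_endExp {A : W →ₗ[𝕜] W'} {T : End 𝕜 W} {T' : End 𝕜 W'} (h : A ∘ₗ T = T' ∘ₗ A) (w : W) :
    A (endExp T w) = endExp T' (A w) := by
  have hpow (n : ℕ) : A ((T ^ n) w) = (T' ^ n) (A w) :=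
    LinearMap.congr_fun (Module.End.commute_pow_left_of_commute h.symm n).symm w
  rw [← sub_eq_zero, ← forall_dual_apply_eq_zero_iff 𝕜]
  intro f
  rw [map_sub, sub_eq_zero]
  refine (hasSum_endExp T w (f ∘ₗ A)).unique ?_
  simpa only [LinearMap.comp_apply, hpow] using hasSum_endExp T' (A w) f

theorem endExp_apply_of_apply_apply_eq_zero {T : End 𝕜 W} {w : W} (h : T (T w) = 0) :
    endExp T w = w + T w := by
  rw [← sub_eq_zero, ← forall_dual_apply_eq_zero_iff 𝕜]
  intro f
  rw [map_sub, sub_eq_zero]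
  have hvanish (n : ℕ) (hn : n ∉ Finset.range 2) : (n ! : 𝕜)⁻¹ * f ((T ^ n) w) = 0 := by
    obtain ⟨k, rfl⟩ := Nat.exists_eq_add_of_le' (not_lt.1 (mt Finset.mem_range.2 hn))
    rw [pow_add, pow_two, End.mul_apply, End.mul_apply, h, map_zero, map_zero, mul_zero]
  refine (hasSum_endExp T w f).unique ?_
  simpa [Finset.sum_range_succ] using hasSum_sum_of_ne_finset_zero hvanish

theorem endExp_zero : endExp (0 : End 𝕜 W) = 1 := by
  ext w
  simp [endExp_apply_of_apply_apply_eq_zero (T := (0 : End 𝕜 W)) (w := w) (by simp)]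

theorem endExp_mul_endExp_neg (T : End 𝕜 W) : endExp T * endExp (-T) = 1 := by
  rw [← endExp_add (Commute.refl T).neg_right, add_neg_cancel, endExp_zero]

/-- The exponential of an endomorphism, as a linear automorphism with inverse `exp (-T)`. -/
noncomputable def endExpEquiv (T : End 𝕜 W) : W ≃ₗ[𝕜] W :=
  have hneg : endExp (-T) * endExp T = 1 := by simpa only [neg_neg] using endExp_mul_endExp_neg (-T)
  LinearEquiv.ofLinearMap (endExp T) (endExp (-T)) (endExp_mul_endExp_neg T) hneg

theorem endExp_apply_sub_mem {T : End 𝕜 W} {J : Submodule 𝕜 W} (hJ : J ≤ J.comap T) {w : W}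
    (h : T (T w) ∈ J) : endExp T w - (w + T w) ∈ J := by
  have hquot : J.mkQ (endExp T w) = endExp (J.mapQ J T hJ) (J.mkQ w) := apply_endExp (by ext; rfl) w
  rw [endExp_apply_of_apply_apply_eq_zero (T := J.mapQ J T hJ) (w := J.mkQ w)
    ((Submodule.Quotient.mk_eq_zero J (x := T (T w))).2 h)] at hquot
  exact (Submodule.Quotient.eq J).1 hquot

open scoped TensorProduct in
/-- Factor `B` through the tensor product and exponentiate the commuting maps `T ⊗ 1`, `1 ⊗ T`. -/
theorem endExp_apply_bilin (B : W →ₗ[𝕜] W' →ₗ[𝕜] W'') {T : End 𝕜 W} {T' : End 𝕜 W'}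
    {T'' : End 𝕜 W''} (h : ∀ u v, T'' (B u v) = B (T u) v + B u (T' v)) (u : W) (v : W') :
    endExp T'' (B u v) = B (endExp T u) (endExp T' v) := by
  have hcomm : Commute (T.rTensor W') (T'.lTensor W) := by
    rw [Commute, SemiconjBy, End.mul_eq_comp, End.mul_eq_comp,
      LinearMap.rTensor_comp_lTensor, LinearMap.lTensor_comp_rTensor]
  have hleft (v : W') : endExp (T.rTensor W') (u ⊗ₜ v) = endExp T u ⊗ₜ v :=
    (apply_endExp (A := (TensorProduct.mk 𝕜 W W').flip v) (by ext; simp) u).symm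
  have hright : endExp (T'.lTensor W) (u ⊗ₜ v) = u ⊗ₜ endExp T' v :=
    (apply_endExp (A := TensorProduct.mk 𝕜 W W' u) (by ext; simp) v).symm
  calc endExp T'' (B u v) = TensorProduct.lift B (endExp (T.rTensor W' + T'.lTensor W) (u ⊗ₜ v)) :=
        (apply_endExp (A := TensorProduct.lift B) (by ext u v; simp [h]) (u ⊗ₜ v)).symm
    _ = B (endExp T u) (endExp T' v) := by
        rw [endExp_add hcomm, End.mul_apply, hright, hleft, TensorProduct.lift.tmul]

end Exponential

section Graded

open Module

theorem ext_of_isInternal {R V M ι : Type*} [Semiring R] [AddCommMonoid V] [Module R V]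
    [AddCommMonoid M] [Module R M] [DecidableEq ι] {𝒜 : ι → Submodule R V}
    (h𝒜 : DirectSum.IsInternal 𝒜) {f g : V →ₗ[R] M} (h : ∀ i, ∀ v ∈ 𝒜 i, f v = g v) : f = g := by
  refine LinearMap.ext fun v => ?_
  have hle : iSup 𝒜 ≤ LinearMap.eqLocus f g := iSup_le h
  rw [h𝒜.submodule_iSup_eq_top] at hle
  exact hle trivial

variable {𝕜 : Type*} [RCLike 𝕜] {V : Type*} [AddCommGroup V] [Module 𝕜 V] {ι : Type*}
  [DecidableEq ι] {𝒜 : ι → Submodule 𝕜 V} (h𝒜 : DirectSum.IsInternal 𝒜)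
  [∀ i, FiniteDimensional 𝕜 (𝒜 i)] {D : End 𝕜 V} (hD : ∀ i, ∀ v ∈ 𝒜 i, D v ∈ 𝒜 i)

/-- The exponential of a grading-preserving endomorphism of a graded space with finite-dimensional
homogeneous components, computed componentwise. -/
noncomputable def gradedExp : V ≃ₗ[𝕜] V :=
  let e := LinearEquiv.ofBijective (DirectSum.coeLinearMap 𝒜) h𝒜
  e.symm ≪≫ₗ DirectSum.congrLinearEquiv (fun i => endExpEquiv (D.restrict (hD i))) ≪≫ₗ e

theorem gradedExp_apply (i : ι) (v : 𝒜 i) :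
    gradedExp h𝒜 hD (v : V) = endExp (D.restrict (hD i)) v := by
  have hv : (LinearEquiv.ofBijective (DirectSum.coeLinearMap 𝒜) h𝒜).symm (v : V) =
      DirectSum.lof 𝕜 ι (fun i => 𝒜 i) i v := by
    rw [LinearEquiv.symm_apply_eq]
    exact (DirectSum.coeLinearMap_lof 𝒜 i v).symm
  rw [gradedExp, LinearEquiv.trans_apply, LinearEquiv.trans_apply, hv,
    DirectSum.coe_congrLinearEquiv, DirectSum.lmap_lof]
  exact DirectSum.coeLinearMap_lof 𝒜 i _

theorem gradedExp_apply_sub_mem {J : Submodule 𝕜 V} (hJ : ∀ x ∈ J, D x ∈ J) {i : ι} {w : V}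
    (hw : w ∈ 𝒜 i) (h : D (D w) ∈ J) : gradedExp h𝒜 hD w - (w + D w) ∈ J := by
  rw [gradedExp_apply h𝒜 hD i ⟨w, hw⟩]
  exact endExp_apply_sub_mem (T := D.restrict (hD i)) (J := J.comap (𝒜 i).subtype)
    (w := ⟨w, hw⟩) (fun x hx => hJ x hx) h

theorem gradedExp_apply_eq_self {i : ι} {w : V} (hw : w ∈ 𝒜 i) (h : D w = 0) :
    gradedExp h𝒜 hD w = w := by
  have hmem := gradedExp_apply_sub_mem h𝒜 hD (J := ⊥) (by simp) hw (by simp [h])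
  rwa [h, add_zero, Submodule.mem_bot, sub_eq_zero] at hmem

theorem gradedExp_apply_bilin {B : V →ₗ[𝕜] V →ₗ[𝕜] V}
    (hB : ∀ i j, ∃ k, ∀ u ∈ 𝒜 i, ∀ v ∈ 𝒜 j, B u v ∈ 𝒜 k)
    (h : ∀ u v, D (B u v) = B (D u) v + B u (D v)) (u v : V) :
    gradedExp h𝒜 hD (B u v) = B (gradedExp h𝒜 hD u) (gradedExp h𝒜 hD v) := by
  let g : V →ₗ[𝕜] V := gradedExp h𝒜 hD
  suffices B.compr₂ g = B.compl₁₂ g g from LinearMap.congr_fun₂ this u v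
  refine ext_of_isInternal h𝒜 fun i u hu => ext_of_isInternal h𝒜 fun j v hv => ?_
  obtain ⟨k, hk⟩ := hB i j
  let Bᵢⱼ : 𝒜 i →ₗ[𝕜] 𝒜 j →ₗ[𝕜] 𝒜 k :=
    LinearMap.mk₂ 𝕜 (fun u v => ⟨B u v, hk u u.2 v v.2⟩)
      (fun u u' v => Subtype.ext (by simp)) (fun c u v => Subtype.ext (by simp))
      (fun u v v' => Subtype.ext (by simp)) (fun c u v => Subtype.ext (by simp))
  have hexp : endExp (D.restrict (hD k)) (Bᵢⱼ ⟨u, hu⟩ ⟨v, hv⟩) =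
      Bᵢⱼ (endExp (D.restrict (hD i)) ⟨u, hu⟩) (endExp (D.restrict (hD j)) ⟨v, hv⟩) :=
    endExp_apply_bilin Bᵢⱼ (fun u v => Subtype.ext (h u v)) ⟨u, hu⟩ ⟨v, hv⟩
  calc gradedExp h𝒜 hD (B u v) = endExp (D.restrict (hD k)) (Bᵢⱼ ⟨u, hu⟩ ⟨v, hv⟩) :=
        gradedExp_apply h𝒜 hD k (Bᵢⱼ ⟨u, hu⟩ ⟨v, hv⟩)
    _ = B (endExp (D.restrict (hD i)) ⟨u, hu⟩) (endExp (D.restrict (hD j)) ⟨v, hv⟩) :=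
        congrArg Subtype.val hexp
    _ = B (gradedExp h𝒜 hD u) (gradedExp h𝒜 hD v) := by
        rw [← gradedExp_apply h𝒜 hD i, ← gradedExp_apply h𝒜 hD j]

end Graded

/-! ### Vertex operator algebras -/

theorem apply_eq_zero_of_mem_map₂ {R M N P Q : Type*} [CommSemiring R] [AddCommMonoid M]
    [AddCommMonoid N] [AddCommMonoid P] [AddCommMonoid Q] [Module R M] [Module R N] [Module R P]
    [Module R Q] {β : M →ₗ[R] N →ₗ[R] P} {S : Submodule R M} {T : Submodule R N} (f : P →ₗ[R] Q)
    (h : ∀ a ∈ S, ∀ b ∈ T, f (β a b) = 0) {x : P} (hx : x ∈ Submodule.map₂ β S T) : f x = 0 := by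
  have hle : Submodule.map₂ β S T ≤ LinearMap.ker f := Submodule.map₂_le.2 h
  exact hle hx

theorem exists_dual_apply_smul_eq {K V : Type*} [Field K] [AddCommGroup V] [Module K V] (v : V) :
    ∃ f : Module.Dual K V, ∀ x ∈ K ∙ v, f x • v = x := by
  obtain rfl | hv := eq_or_ne v 0
  · exact ⟨0, fun x hx => by simpa [eq_comm] using hx⟩
  · obtain ⟨f, hf⟩ := Module.Projective.exists_dual_eq_one K hv
    refine ⟨f, fun x hx => ?_⟩
    obtain ⟨c, rfl⟩ := Submodule.mem_span_singleton.1 hx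
    rw [map_smul, hf, smul_eq_mul, mul_one]

namespace VertexOperatorAlgebra

variable {V : Type*} [AddCommGroup V] [Module ℂ V] (𝒱 : VertexOperatorAlgebra V)

section Commutator

theorem lie_mode_apply_eq_finsum (u v w : V) (p q : ℤ) :
    ⁅𝒱.mode u p, 𝒱.mode v q⁆ w =
      ∑ᶠ i : ℕ, ((Ring.choose p i : ℤ) : ℂ) • 𝒱.mode (𝒱.mode u i v) (p + q - i) w := by
  have hjacobi := 𝒱.jacobi u v w p q 0
  rw [finsum_eq_single (fun i : ℕ => ((-1 : ℂ) ^ i * ((Ring.choose (0 : ℤ) i : ℤ) : ℂ)) •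
        vertexMode 𝒱.Y (p + 0 - i) u (vertexMode 𝒱.Y (q + i) v w)) 0,
    finsum_eq_single (fun i : ℕ => ((-1 : ℂ) ^ (0 : ℤ) * (-1 : ℂ) ^ i *
      ((Ring.choose (0 : ℤ) i : ℤ) : ℂ)) •
        vertexMode 𝒱.Y (q + 0 - i) v (vertexMode 𝒱.Y (p + i) u w)) 0] at hjacobi
  · simpa [LieRing.of_associative_ring_bracket] using hjacobi.symm
  all_goals
    intro i hi
    simp [Ring.choose_zero_ite, hi]

theorem lie_mode_eq_sum {u v : V} {p : ℤ} {k : ℕ}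
    (h : ∀ i : ℕ, k ≤ i → Ring.choose p i = 0 ∨ 𝒱.mode u i v = 0) (q : ℤ) :
    ⁅𝒱.mode u p, 𝒱.mode v q⁆ =
      ∑ i ∈ Finset.range k,
        ((Ring.choose p i : ℤ) : ℂ) • 𝒱.mode (𝒱.mode u i v) (p + q - i) := by
  ext w
  rw [lie_mode_apply_eq_finsum, LinearMap.sum_apply]
  refine finsum_eq_sum_of_support_subset _ fun i hi => ?_
  by_contra hk
  rw [Finset.mem_coe, Finset.mem_range, not_lt] at hk
  obtain hi' | hi' := h i hk <;> exact hi (by simp [hi'])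

theorem lie_mode_natCast_eq_sum (u v : V) (m : ℕ) (q : ℤ) :
    ⁅𝒱.mode u m, 𝒱.mode v q⁆ =
      ∑ i ∈ Finset.range (m + 1), (m.choose i : ℂ) • 𝒱.mode (𝒱.mode u i v) (m + q - i) := by
  rw [𝒱.lie_mode_eq_sum (k := m + 1) fun i hi => Or.inl ?_]
  · simp only [Ring.choose_natCast, Int.cast_natCast]
  · rw [Ring.choose_natCast, Nat.choose_eq_zero_of_lt hi, Nat.cast_zero]

theorem lie_mode_eq_zero {u v : V} (h : ∀ i : ℕ, 𝒱.mode u i v = 0) (p q : ℤ) :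
    ⁅𝒱.mode u p, 𝒱.mode v q⁆ = 0 := by
  rw [𝒱.lie_mode_eq_sum (k := 0) fun i _ => Or.inr (h i), Finset.sum_range_zero]

theorem mode_zero_mode (u v w : V) (q : ℤ) :
    𝒱.mode u 0 (𝒱.mode v q w) = 𝒱.mode (𝒱.mode u 0 v) q w + 𝒱.mode v q (𝒱.mode u 0 w) := by
  have hlie := LinearMap.congr_fun (𝒱.lie_mode_natCast_eq_sum u v 0 q) w
  rw [zero_add, Finset.sum_range_one, Nat.choose_self, Nat.cast_one, one_smul, Nat.cast_zero,
    zero_add, sub_zero] at hlie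
  exact sub_eq_iff_eq_add.1 hlie

theorem mode_one_mode (u v w : V) (q : ℤ) :
    𝒱.mode u 1 (𝒱.mode v q w) = 𝒱.mode (𝒱.mode u 0 v) (q + 1) w +
      𝒱.mode (𝒱.mode u 1 v) q w + 𝒱.mode v q (𝒱.mode u 1 w) := by
  have hlie := LinearMap.congr_fun (𝒱.lie_mode_natCast_eq_sum u v 1 q) w
  simp only [Finset.sum_range_succ, Finset.sum_range_zero, zero_add, Nat.choose_zero_right,
    Nat.choose_self, Nat.cast_zero, Nat.cast_one, one_smul, sub_zero, add_comm 1 q,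
    add_sub_cancel_right] at hlie
  exact sub_eq_iff_eq_add.1 hlie

theorem mode_vacuum_of_nonneg (u : V) {n : ℤ} (hn : 0 ≤ n) : 𝒱.mode u n 𝒱.vacuum = 0 := by
  rw [mode, 𝒱.mode_vacuum u n (by omega), if_neg (by omega)]

theorem mode_neg_one_vacuum (u : V) : 𝒱.mode u (-1) 𝒱.vacuum = u := by
  rw [mode, 𝒱.mode_vacuum u (-1) le_rfl, if_pos rfl]

theorem mode_neg_two_vacuum (u : V) : 𝒱.mode u (-2) 𝒱.vacuum = 𝒱.mode 𝒱.conformal 0 u := by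
  have htranslation := LinearMap.congr_fun (𝒱.translation u (-1)) 𝒱.vacuum
  rw [Int.cast_neg, Int.cast_one, neg_neg, one_smul] at htranslation
  exact htranslation.symm.trans (𝒱.mode_neg_one_vacuum _)

/-- Apply the commutator formula for `[u(-1), v(0)]` to the vacuum. -/
theorem mode_zero_skew {u v : V} (h : ∀ i : ℕ, 2 ≤ i → 𝒱.mode u i v = 0) :
    𝒱.mode u 0 v - 𝒱.mode 𝒱.conformal 0 (𝒱.mode u 1 v) = -𝒱.mode v 0 u := by
  have hlie := LinearMap.congr_fun
    (𝒱.lie_mode_eq_sum (p := -1) (k := 2) (fun i hi => Or.inr (h i hi)) 0) 𝒱.vacuum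
  rw [LieRing.of_associative_ring_bracket, LinearMap.sub_apply, Module.End.mul_apply,
    Module.End.mul_apply, 𝒱.mode_vacuum_of_nonneg v le_rfl, map_zero, 𝒱.mode_neg_one_vacuum,
    zero_sub] at hlie
  rw [hlie, Finset.sum_range_succ, Finset.sum_range_one, LinearMap.add_apply,
    LinearMap.smul_apply, LinearMap.smul_apply, ← mode_neg_two_vacuum, Ring.choose_zero_right,
    Ring.choose_one_right, Int.cast_one, one_smul, Int.cast_neg, Int.cast_one, neg_one_smul,
    ← sub_eq_add_neg]
  exact congrArg₂ _ (𝒱.mode_neg_one_vacuum _).symm rfl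

theorem mode_translation_zero (t : V) : 𝒱.mode (𝒱.mode 𝒱.conformal 0 t) 0 = 0 := by
  rw [mode, 𝒱.translation, Int.cast_zero, neg_zero, zero_smul]

theorem translation_mode_zero (x z : V) :
    𝒱.mode 𝒱.conformal 0 (𝒱.mode x 0 z) = 𝒱.mode x 0 (𝒱.mode 𝒱.conformal 0 z) := by
  rw [mode_zero_mode, mode_translation_zero, LinearMap.zero_apply, zero_add]

end Commutator

section Weight

theorem mem_weightSpace_iff {n : ℤ} {v : V} :
    v ∈ 𝒱.weightSpace n ↔ 𝒱.mode 𝒱.conformal 1 v = (n : ℂ) • v := by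
  have hindep : iSupIndep fun n : ℤ => (𝒱.mode 𝒱.conformal 1).eigenspace (n : ℂ) :=
    (𝒱.mode 𝒱.conformal 1).eigenspaces_iSupIndep.comp Int.cast_injective
  have hle : 𝒱.weightSpace ≤ fun n : ℤ => (𝒱.mode 𝒱.conformal 1).eigenspace (n : ℂ) :=
    fun n w hw => Module.End.mem_eigenspace_iff.2 (𝒱.weight_eq n w hw)
  rw [(hindep.le_iff_eq_of_iSup_eq_top 𝒱.isInternal.submodule_iSup_eq_top).1 hle,
    Module.End.mem_eigenspace_iff]

theorem mode_mem {k l m n : ℤ} {u v : V} (hu : u ∈ 𝒱.weightSpace k) (hv : v ∈ 𝒱.weightSpace l)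
    (h : m = k + l - n - 1) : 𝒱.mode u n v ∈ 𝒱.weightSpace m := by
  rw [mem_weightSpace_iff] at *
  have htranslation := 𝒱.translation u (n + 1)
  rw [add_sub_cancel_right] at htranslation
  rw [mode_one_mode, hu, hv, mode, htranslation, mode, map_smul, map_smul, LinearMap.smul_apply,
    LinearMap.smul_apply, ← add_smul, ← add_smul, h]
  congr 1
  push_cast
  ring

theorem vacuum_mem : 𝒱.vacuum ∈ 𝒱.weightSpace 0 := by
  rw [mem_weightSpace_iff, mode_vacuum_of_nonneg _ _ zero_le_one, Int.cast_zero, zero_smul]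

theorem conformal_mem : 𝒱.conformal ∈ 𝒱.weightSpace 2 := by
  rw [mem_weightSpace_iff]
  have hvirasoro := LinearMap.congr_fun (𝒱.virasoro 0 (-2)) 𝒱.vacuum
  have hone := 𝒱.mode_vacuum_of_nonneg 𝒱.conformal zero_le_one
  have hneg := 𝒱.mode_neg_one_vacuum 𝒱.conformal
  norm_num [LieRing.of_associative_ring_bracket, hone, hneg] at hvirasoro
  rw [hvirasoro]
  norm_num

end Weight

section VacuumLike

/-- The space of vacuum-like vectors, i.e. the kernel of the translation operator `L(-1)`. -/
def vacuumLike : Submodule ℂ V := LinearMap.ker (𝒱.mode 𝒱.conformal 0)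

variable {𝒱}

theorem mode_eq_zero_of_mem_vacuumLike {v : V} (hv : v ∈ 𝒱.vacuumLike) {n : ℤ} (hn : n ≠ -1) :
    𝒱.mode v n = 0 := by
  have htranslation := 𝒱.translation v (n + 1)
  rw [show vertexMode 𝒱.Y 0 𝒱.conformal v = 0 from hv, map_zero, add_sub_cancel_right]
    at htranslation
  refine (smul_eq_zero.1 htranslation.symm).resolve_left ?_
  exact neg_ne_zero.2 (Int.cast_ne_zero.2 (by omega))

theorem commute_mode_of_mem_vacuumLike {v : V} (hv : v ∈ 𝒱.vacuumLike) (p : ℤ) (u : V) (q : ℤ) :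
    Commute (𝒱.mode v p) (𝒱.mode u q) := by
  refine commute_iff_lie_eq.2 (𝒱.lie_mode_eq_zero (fun i => ?_) p q)
  rw [mode_eq_zero_of_mem_vacuumLike hv (by omega), LinearMap.zero_apply]

theorem mode_eq_zero_of_mem_vacuumLike_of_nonneg {v : V} (hv : v ∈ 𝒱.vacuumLike) (u : V) {q : ℤ}
    (hq : 0 ≤ q) : 𝒱.mode u q v = 0 := by
  have hcomm := LinearMap.congr_fun (commute_mode_of_mem_vacuumLike hv (-1) u q) 𝒱.vacuum
  rw [Module.End.mul_apply, Module.End.mul_apply, 𝒱.mode_vacuum_of_nonneg u hq, map_zero,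
    𝒱.mode_neg_one_vacuum] at hcomm
  exact hcomm.symm

theorem IsSimple.vacuum_ne_zero (h : 𝒱.IsSimple) : 𝒱.vacuum ≠ 0 := by
  intro hzero
  have := h.1
  obtain ⟨v, hv⟩ := exists_ne (0 : V)
  exact hv (by rw [← 𝒱.mode_neg_one_vacuum v, hzero, map_zero])

/-- Schur's lemma; an eigenvector is found in the finite-dimensional space `V_0 ∋ 𝟏`. -/
theorem IsSimple.exists_apply_eq_smul (h : 𝒱.IsSimple) {T : Module.End ℂ V}
    (hT : ∀ u n, Commute T (𝒱.mode u n)) : ∃ c : ℂ, ∀ v, T v = c • v := by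
  have hfin := 𝒱.finiteDimensional 0
  have hnontrivial : Nontrivial (𝒱.weightSpace 0) :=
    ⟨⟨𝒱.vacuum, 𝒱.vacuum_mem⟩, 0, fun hzero => h.vacuum_ne_zero (congrArg Subtype.val hzero)⟩
  have hmaps : ∀ w ∈ 𝒱.weightSpace 0, T w ∈ 𝒱.weightSpace 0 := by
    intro w hw
    rw [mem_weightSpace_iff] at *
    rw [← Module.End.mul_apply, ← hT, Module.End.mul_apply, hw, map_smul]
  obtain ⟨c, hc⟩ := Module.End.exists_eigenvalue (T.restrict hmaps)
  obtain ⟨w, hw, hw₀⟩ := hc.exists_hasEigenvector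
  have hwc : (w : V) ∈ T.eigenspace c :=
    Module.End.mem_eigenspace_iff.2 (congrArg Subtype.val (Module.End.mem_eigenspace_iff.1 hw))
  have htop : T.eigenspace c = ⊤ :=
    (h.2 _ fun u n _ hx => Module.End.mapsTo_genEigenspace_of_comm (hT u n) c 1 hx).resolve_left
      fun hbot => hw₀ (Subtype.ext ((Submodule.mem_bot ℂ).1 (hbot ▸ hwc)))
  exact ⟨c, fun v => Module.End.mem_eigenspace_iff.1 (htop ▸ Submodule.mem_top)⟩

theorem IsSimple.vacuumLike_le (h : 𝒱.IsSimple) : 𝒱.vacuumLike ≤ ℂ ∙ 𝒱.vacuum := by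
  intro v hv
  obtain ⟨c, hc⟩ := h.exists_apply_eq_smul (commute_mode_of_mem_vacuumLike hv (-1))
  rw [← 𝒱.mode_neg_one_vacuum v, hc]
  exact Submodule.smul_mem _ c (Submodule.mem_span_singleton_self _)

end VacuumLike

variable {𝒱}

section LeibnizKernel

theorem bracket_add_bracket_mem_leibnizKernel {a b : V} (ha : a ∈ 𝒱.weightSpace 1)
    (hb : b ∈ 𝒱.weightSpace 1) : 𝒱.bracket a b + 𝒱.bracket b a ∈ 𝒱.leibnizKernel := by
  have hsq (c : V) (hc : c ∈ 𝒱.weightSpace 1) : 𝒱.bracket c c ∈ 𝒱.leibnizKernel :=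
    Submodule.subset_span ⟨c, hc, rfl⟩
  have hpolar : 𝒱.bracket a b + 𝒱.bracket b a =
      𝒱.bracket (a + b) (a + b) - 𝒱.bracket a a - 𝒱.bracket b b := by
    simp only [map_add, LinearMap.add_apply]
    abel
  rw [hpolar]
  exact sub_mem (sub_mem (hsq _ (add_mem ha hb)) (hsq a ha)) (hsq b hb)

theorem leibnizKernel_le_weightSpace_one : 𝒱.leibnizKernel ≤ 𝒱.weightSpace 1 := by
  refine Submodule.span_le.2 ?_
  rintro _ ⟨a, ha, rfl⟩
  exact 𝒱.mode_mem ha ha (by norm_num)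

theorem bracket_eq_zero_of_mem_leibnizKernel {x : V} (hx : x ∈ 𝒱.leibnizKernel) (c : V) :
    𝒱.bracket x c = 0 := by
  suffices 𝒱.leibnizKernel ≤ LinearMap.ker (𝒱.bracket.flip c) from this hx
  refine Submodule.span_le.2 ?_
  rintro _ ⟨a, -, rfl⟩
  exact right_eq_add.1 (𝒱.isLeftLeibniz_bracket a a c)

theorem kernelAnnihilator_le_weightSpace_one : 𝒱.kernelAnnihilator ≤ 𝒱.weightSpace 1 :=
  fun _ h => h.1

instance : FiniteDimensional ℂ 𝒱.kernelAnnihilator :=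
  have := 𝒱.finiteDimensional 1
  Submodule.finiteDimensional_of_le kernelAnnihilator_le_weightSpace_one

theorem isIdealOf_leibnizKernel :
    LeibnizAlg.IsIdealOf 𝒱.bracket 𝒱.kernelAnnihilator 𝒱.leibnizKernel :=
  ⟨fun _ hx => ⟨leibnizKernel_le_weightSpace_one hx,
      fun _ _ => bracket_eq_zero_of_mem_leibnizKernel hx _⟩,
    fun a ha x hx => by
      rw [ha.2 x hx, bracket_eq_zero_of_mem_leibnizKernel hx]
      exact ⟨zero_mem _, zero_mem _⟩⟩

theorem isSolvable_leibnizKernel : LeibnizAlg.IsSolvable 𝒱.bracket 𝒱.leibnizKernel :=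
  ⟨1, le_bot_iff.1 <| Submodule.map₂_le.2 fun _ hx _ _ =>
    (Submodule.mem_bot ℂ).2 (bracket_eq_zero_of_mem_leibnizKernel hx _)⟩

end LeibnizKernel

section Perfect

variable {S : Submodule ℂ V} (hperf : S ≤ Submodule.map₂ 𝒱.bracket S S)

include hperf

theorem mode_zero_eq_zero_of_mode_zero_mode_zero {z : V}
    (h : ∀ u ∈ S, ∀ v ∈ S, 𝒱.mode u 0 (𝒱.mode v 0 z) = 0) {x : V} (hx : x ∈ S) :
    𝒱.mode x 0 z = 0 := by
  refine apply_eq_zero_of_mem_map₂ ((vertexMode 𝒱.Y 0).flip z) (fun u hu v hv => ?_) (hperf hx)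
  have hleibniz := 𝒱.mode_zero_mode u v z 0
  rw [h u hu v hv, h v hv u hu, add_zero] at hleibniz
  exact hleibniz.symm

theorem mode_zero_eq_zero_of_mode_zero_translation {z : V}
    (h : ∀ x ∈ S, 𝒱.mode x 0 (𝒱.mode 𝒱.conformal 0 z) = 0) {x : V} (hx : x ∈ S) :
    𝒱.mode x 0 z = 0 := by
  refine mode_zero_eq_zero_of_mode_zero_mode_zero hperf (fun u _ v hv => ?_) hx
  have hvac : 𝒱.mode v 0 z ∈ 𝒱.vacuumLike := (𝒱.translation_mode_zero v z).trans (h v hv)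
  exact mode_eq_zero_of_mem_vacuumLike_of_nonneg hvac u le_rfl

variable (hF : S ≤ 𝒱.kernelAnnihilator)

include hF

theorem mode_zero_eq_zero_of_weight_zero {z : V} (hz : z ∈ 𝒱.weightSpace 0) {x : V} (hx : x ∈ S) :
    𝒱.mode x 0 z = 0 := by
  refine mode_zero_eq_zero_of_mode_zero_translation hperf (fun x hx =>
    mode_zero_eq_zero_of_mode_zero_mode_zero hperf (fun u hu v hv => (hF hu).2 _ ?_) hx) hx
  have hkernel := bracket_add_bracket_mem_leibnizKernel (hF hv).1
    (𝒱.mode_mem (n := 0) 𝒱.conformal_mem hz (by norm_num))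
  rwa [show 𝒱.bracket (𝒱.mode 𝒱.conformal 0 z) v = 0 from
    LinearMap.congr_fun (𝒱.mode_translation_zero z) v, add_zero] at hkernel

theorem mode_zero_eq_zero_of_weight_nonpos {k : ℤ} (hk : k ≤ 0) {z : V}
    (hz : z ∈ 𝒱.weightSpace k) {x : V} (hx : x ∈ S) : 𝒱.mode x 0 z = 0 := by
  induction k, hk using Int.leInductionDown generalizing z x with
  | base => exact mode_zero_eq_zero_of_weight_zero hperf hF hz hx
  | pred k _ ih =>
    exact mode_zero_eq_zero_of_mode_zero_translation hperf
      (fun _ => ih (𝒱.mode_mem 𝒱.conformal_mem hz (by ring))) hx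

theorem mode_eq_zero_of_weight_nonpos {k : ℤ} (hk : k ≤ 0) {z : V} (hz : z ∈ 𝒱.weightSpace k)
    {x : V} (hx : x ∈ S) {n : ℤ} (hn : 0 ≤ n) : 𝒱.mode x n z = 0 := by
  refine apply_eq_zero_of_mem_map₂ ((vertexMode 𝒱.Y n).flip z) (fun u hu v hv => ?_) (hperf hx)
  have hvz : 𝒱.mode v n z ∈ 𝒱.weightSpace (k - n) := 𝒱.mode_mem (hF hv).1 hz (by ring)
  have hleibniz := 𝒱.mode_zero_mode u v z n
  rw [mode_zero_eq_zero_of_weight_nonpos hperf hF hk hz hu, map_zero, add_zero,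
    mode_zero_eq_zero_of_weight_nonpos hperf hF (by omega) hvz hu] at hleibniz
  exact hleibniz.symm

theorem mode_of_weight_nonpos_eq_zero {k : ℤ} (hk : k ≤ 0) {z : V} (hz : z ∈ 𝒱.weightSpace k)
    {x : V} (hx : x ∈ S) {n : ℤ} (hn : 0 ≤ n) : 𝒱.mode z n x = 0 := by
  have hlie := LinearMap.congr_fun (𝒱.lie_mode_eq_zero (u := x) (v := z)
    (fun i => mode_eq_zero_of_weight_nonpos hperf hF hk hz hx i.cast_nonneg) (-1) n) 𝒱.vacuum
  rwa [LieRing.of_associative_ring_bracket, LinearMap.sub_apply, Module.End.mul_apply,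
    Module.End.mul_apply, 𝒱.mode_vacuum_of_nonneg z hn, map_zero, 𝒱.mode_neg_one_vacuum,
    zero_sub, LinearMap.zero_apply, neg_eq_zero] at hlie

theorem mode_eq_zero_of_two_le {x w : V} (hx : x ∈ S) (hw : w ∈ S) {k : ℤ} (hk : 2 ≤ k) :
    𝒱.mode x k w = 0 := by
  refine apply_eq_zero_of_mem_map₂ ((vertexMode 𝒱.Y k).flip w) (fun u hu v hv => ?_) (hperf hx)
  have huv : 𝒱.mode u 1 v ∈ 𝒱.weightSpace 0 := 𝒱.mode_mem (hF hu).1 (hF hv).1 (by ring)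
  have huw : 𝒱.mode u 1 w ∈ 𝒱.weightSpace 0 := 𝒱.mode_mem (hF hu).1 (hF hw).1 (by ring)
  have hvw : 𝒱.mode v (k - 1) w ∈ 𝒱.weightSpace (2 - k) :=
    𝒱.mode_mem (hF hv).1 (hF hw).1 (by ring)
  have hone := 𝒱.mode_one_mode u v w (k - 1)
  rw [mode_eq_zero_of_weight_nonpos hperf hF (by omega) hvw hu zero_le_one,
    mode_eq_zero_of_weight_nonpos hperf hF le_rfl huw hv (by omega),
    mode_of_weight_nonpos_eq_zero hperf hF le_rfl huv hw (by omega),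
    add_zero, add_zero, sub_add_cancel] at hone
  exact hone.symm

end Perfect

section Affine

theorem lie_mode_of_mode_eq_zero {u v : V} (h : ∀ i : ℕ, 2 ≤ i → 𝒱.mode u i v = 0) (m n : ℤ) :
    ⁅𝒱.mode u m, 𝒱.mode v n⁆ =
      𝒱.mode (𝒱.mode u 0 v) (m + n) + (m : ℂ) • 𝒱.mode (𝒱.mode u 1 v) (m + n - 1) := by
  rw [𝒱.lie_mode_eq_sum (fun i hi => Or.inr (h i hi)), Finset.sum_range_succ,
    Finset.sum_range_one, Ring.choose_zero_right, Ring.choose_one_right, Int.cast_one, one_smul,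
    Nat.cast_zero, sub_zero, Nat.cast_one]

theorem mode_smul_vacuum (c : ℂ) (n : ℤ) :
    𝒱.mode (c • 𝒱.vacuum) (n - 1) = (if n = 0 then c else 0) • LinearMap.id := by
  rw [mode, map_smul, 𝒱.vacuum_mode]
  by_cases hn : n = 0 <;> simp [hn]

variable {S : Submodule ℂ V}

theorem mode_one_mem_vacuumLike (hperf : S ≤ Submodule.map₂ 𝒱.bracket S S)
    (hF : S ≤ 𝒱.kernelAnnihilator) (halt : ∀ a ∈ S, 𝒱.bracket a a = 0) {u v : V} (hu : u ∈ S)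
    (hv : v ∈ S) : 𝒱.mode u 1 v ∈ 𝒱.vacuumLike := by
  have hskew := 𝒱.mode_zero_skew (u := u) (v := v) fun i hi =>
    mode_eq_zero_of_two_le hperf hF hu hv (by omega)
  have hanti : 𝒱.mode u 0 v = -𝒱.mode v 0 u := by
    have hadd := halt (u + v) (S.add_mem hu hv)
    rw [map_add, map_add, LinearMap.add_apply, LinearMap.add_apply, halt u hu, halt v hv,
      zero_add, add_zero] at hadd
    exact eq_neg_of_add_eq_zero_right hadd
  rwa [hanti, sub_eq_self] at hskew

theorem exists_affine_form (hperf : S ≤ Submodule.map₂ 𝒱.bracket S S)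
    (hF : S ≤ 𝒱.kernelAnnihilator) (halt : ∀ a ∈ S, 𝒱.bracket a a = 0)
    (hvac : 𝒱.vacuumLike ≤ ℂ ∙ 𝒱.vacuum) :
    ∃ α : LinearMap.BilinForm ℂ S, ∀ u v : S,
      𝒱.mode u 1 v = α u v • 𝒱.vacuum ∧
      ∀ m n : ℤ, ⁅𝒱.mode u m, 𝒱.mode v n⁆ =
        𝒱.mode (𝒱.mode u 0 v) (m + n) +
          (if m + n = 0 then (m : ℂ) * α u v else 0) • LinearMap.id := by
  obtain ⟨f, hf⟩ := exists_dual_apply_smul_eq (K := ℂ) 𝒱.vacuum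
  let α : LinearMap.BilinForm ℂ S :=
    ((vertexMode 𝒱.Y 1).compr₂ f).compl₁₂ S.subtype S.subtype
  have hα (u v : S) : 𝒱.mode u 1 v = α u v • 𝒱.vacuum :=
    (hf _ (hvac (mode_one_mem_vacuumLike hperf hF halt u.2 v.2))).symm
  refine ⟨α, fun u v => ⟨hα u v, fun m n => ?_⟩⟩
  rw [lie_mode_of_mode_eq_zero fun i hi => mode_eq_zero_of_two_le hperf hF u.2 v.2 (by omega),
    hα, mode_smul_vacuum, smul_smul, mul_ite, mul_zero]

end Affine

section Primary

/-- In the commutator formula for `[ω(m), s(0)]` the terms with `(L(-1)s)(m) = -m s(m-1)` and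
`m (L(0)s)(m-1) = m s(m-1)` cancel. -/
theorem conformal_mode_mode_zero {s b : V} (hs : s ∈ 𝒱.weightSpace 1) {m : ℕ}
    (h : ∀ i : ℕ, 2 ≤ i → i ≤ m → 𝒱.mode (𝒱.mode 𝒱.conformal i s) (m - i) b = 0) :
    𝒱.mode 𝒱.conformal m (𝒱.mode s 0 b) = 𝒱.mode s 0 (𝒱.mode 𝒱.conformal m b) := by
  obtain _ | k := m
  · exact 𝒱.translation_mode_zero s b
  have hlie := LinearMap.congr_fun (𝒱.lie_mode_natCast_eq_sum 𝒱.conformal s (k + 1) 0) b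
  rw [Finset.sum_range_succ', Finset.sum_range_succ', LinearMap.add_apply, LinearMap.add_apply,
    LinearMap.sum_apply, Finset.sum_eq_zero, zero_add] at hlie
  · have htranslation : 𝒱.mode (𝒱.mode 𝒱.conformal 0 s) (k + 1) = -((k : ℂ) + 1) • 𝒱.mode s k := by
      rw [mode, mode, 𝒱.translation, add_sub_cancel_right]
      push_cast
      rfl
    have hweight : 𝒱.mode 𝒱.conformal 1 s = s := by
      rw [𝒱.mem_weightSpace_iff.1 hs, Int.cast_one, one_smul]
    refine sub_eq_zero.1 (hlie.trans ?_)
    simp [htranslation, hweight, ← add_smul]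
  · intro i hi
    have hik : i < k := Finset.mem_range.1 hi
    rw [LinearMap.smul_apply, add_zero]
    exact smul_eq_zero_of_right _ (h (i + 2) (by omega) (by omega))

variable {S : Submodule ℂ V} (hperf : S ≤ Submodule.map₂ 𝒱.bracket S S)
  (hF : S ≤ 𝒱.kernelAnnihilator)

include hperf hF

theorem conformal_mode_eq_zero_of_mem {x : V} (hx : x ∈ S) {m : ℕ} (hm : 2 ≤ m) :
    𝒱.mode 𝒱.conformal m x = 0 := by
  refine apply_eq_zero_of_mem_map₂ (𝒱.mode 𝒱.conformal m) (fun u hu v hv => ?_) (hperf hx)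
  have hv' : 𝒱.mode 𝒱.conformal m v ∈ 𝒱.weightSpace (2 - m) :=
    𝒱.mode_mem 𝒱.conformal_mem (hF hv).1 (by ring)
  refine (conformal_mode_mode_zero (hF hu).1 fun i hi him => ?_).trans
    (mode_eq_zero_of_weight_nonpos hperf hF (by omega) hv' hu le_rfl)
  have hu' : 𝒱.mode 𝒱.conformal i u ∈ 𝒱.weightSpace (2 - i) :=
    𝒱.mode_mem 𝒱.conformal_mem (hF hu).1 (by ring)
  exact mode_of_weight_nonpos_eq_zero hperf hF (by omega) hu' hv (by omega)

theorem conformal_mode_eq_zero_of_mem_map₂ {a : V}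
    (ha : a ∈ Submodule.map₂ 𝒱.bracket S (𝒱.weightSpace 1)) {m : ℕ} (hm : 2 ≤ m) :
    𝒱.mode 𝒱.conformal m a = 0 := by
  refine apply_eq_zero_of_mem_map₂ (𝒱.mode 𝒱.conformal m) (fun s hs b hb => ?_) ha
  have hb' : 𝒱.mode 𝒱.conformal m b ∈ 𝒱.weightSpace (2 - m) :=
    𝒱.mode_mem 𝒱.conformal_mem hb (by ring)
  refine (conformal_mode_mode_zero (hF hs).1 fun i hi _ => ?_).trans
    (mode_eq_zero_of_weight_nonpos hperf hF (by omega) hb' hs le_rfl)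
  rw [conformal_mode_eq_zero_of_mem hperf hF hs hi, mode, map_zero, LinearMap.zero_apply]

theorem mode_zero_conformal_of_mem_map₂ {a : V}
    (ha : a ∈ Submodule.map₂ 𝒱.bracket S (𝒱.weightSpace 1)) (ha₁ : a ∈ 𝒱.weightSpace 1) :
    𝒱.mode a 0 𝒱.conformal = 0 := by
  have hskew := 𝒱.mode_zero_skew (u := 𝒱.conformal) (v := a) fun i hi =>
    conformal_mode_eq_zero_of_mem_map₂ hperf hF ha hi
  rw [𝒱.mem_weightSpace_iff.1 ha₁, Int.cast_one, one_smul, sub_self] at hskew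
  exact neg_eq_zero.1 hskew.symm

end Primary

section ExpMode

theorem mode_zero_mem {a : V} (ha : a ∈ 𝒱.weightSpace 1) (k : ℤ) (v : V)
    (hv : v ∈ 𝒱.weightSpace k) : 𝒱.mode a 0 v ∈ 𝒱.weightSpace k :=
  𝒱.mode_mem ha hv (by ring)

/-- The exponential of the derivation `a(0)`, for `a` of weight one. -/
noncomputable def expMode {a : V} (ha : a ∈ 𝒱.weightSpace 1) : V ≃ₗ[ℂ] V :=
  haveI := 𝒱.finiteDimensional
  gradedExp 𝒱.isInternal (mode_zero_mem ha)

theorem expMode_mem_aut {a : V} (ha : a ∈ 𝒱.weightSpace 1) (hω : 𝒱.mode a 0 𝒱.conformal = 0) :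
    expMode ha ∈ 𝒱.aut := by
  have := 𝒱.finiteDimensional
  exact ⟨gradedExp_apply_eq_self _ _ 𝒱.vacuum_mem (𝒱.mode_vacuum_of_nonneg a le_rfl),
    gradedExp_apply_eq_self _ _ 𝒱.conformal_mem hω,
    fun u v n => gradedExp_apply_bilin (B := vertexMode 𝒱.Y n) 𝒱.isInternal (mode_zero_mem ha)
      (fun i j => ⟨i + j - n - 1, fun _ hu _ hv => 𝒱.mode_mem hu hv rfl⟩)
      (fun u v => 𝒱.mode_zero_mode a u v n) u v⟩

end ExpMode

section Aut

variable {g : V ≃ₗ[ℂ] V}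

theorem map_mem_weightSpace (hg : g ∈ 𝒱.aut) {n : ℤ} {v : V} (hv : v ∈ 𝒱.weightSpace n) :
    g v ∈ 𝒱.weightSpace n := by
  rw [mem_weightSpace_iff] at *
  rw [← map_smul, ← hv, hg.2.2, hg.2.1]

theorem map_mem_leibnizKernel (hg : g ∈ 𝒱.aut) {x : V} (hx : x ∈ 𝒱.leibnizKernel) :
    g x ∈ 𝒱.leibnizKernel := by
  suffices 𝒱.leibnizKernel ≤ 𝒱.leibnizKernel.comap (g : V →ₗ[ℂ] V) from this hx
  refine Submodule.span_le.2 ?_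
  rintro _ ⟨a, ha, rfl⟩
  exact Submodule.subset_span ⟨g a, map_mem_weightSpace hg ha, hg.2.2 a a 0⟩

theorem map_kernelAnnihilator_le (hg : g ∈ 𝒱.aut) :
    𝒱.kernelAnnihilator.map (g : V →ₗ[ℂ] V) ≤ 𝒱.kernelAnnihilator := by
  rintro _ ⟨a, ha, rfl⟩
  refine ⟨map_mem_weightSpace hg ha.1, fun x hx => ?_⟩
  have hzero : 𝒱.mode a 0 (g.symm x) = 0 :=
    ha.2 _ (map_mem_leibnizKernel (𝒱.aut.inv_mem hg) hx)
  have hmode := hg.2.2 a (g.symm x) 0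
  rw [hzero, map_zero, g.apply_symm_apply] at hmode
  exact hmode.symm

theorem map_kernelAnnihilator (hg : g ∈ 𝒱.aut) :
    𝒱.kernelAnnihilator.map (g : V →ₗ[ℂ] V) = 𝒱.kernelAnnihilator :=
  (map_kernelAnnihilator_le hg).antisymm fun a ha =>
    ⟨_, map_kernelAnnihilator_le (𝒱.aut.inv_mem hg) ⟨a, ha, rfl⟩, g.apply_symm_apply a⟩

theorem IsLevi.map {S : Submodule ℂ V} (hS : 𝒱.IsLevi S) (hg : g ∈ 𝒱.aut) :
    𝒱.IsLevi (S.map (g : V →ₗ[ℂ] V)) := by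
  have : FiniteDimensional ℂ S :=
    Submodule.finiteDimensional_of_le (LeibnizAlg.IsLeviSubalgebra.le hS)
  have hmap := LeibnizAlg.IsLeviSubalgebra.map (hβ' := 𝒱.isLeftLeibniz_bracket) (g := g)
    (fun a b => hg.2.2 a b 0) hS
  rwa [map_kernelAnnihilator hg] at hmap

end Aut

section Conjugacy

open LeibnizAlg

variable {S₁ S₂ : Submodule ℂ V}

variable (𝒱) in
/-- A descending chain of ideals of `F` from the solvable radical to the Leibniz kernel, with
abelian quotients. The Leibniz kernel is added so that `F / radicalFiltration k` is a Lie
algebra. -/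
def radicalFiltration (k : ℕ) : Submodule ℂ V :=
  derivedSeries 𝒱.bracket (solvableRadical 𝒱.bracket 𝒱.kernelAnnihilator) k ⊔ 𝒱.leibnizKernel

theorem isIdealOf_radicalFiltration (k : ℕ) :
    IsIdealOf 𝒱.bracket 𝒱.kernelAnnihilator (𝒱.radicalFiltration k) :=
  (isIdealOf_solvableRadical.derivedSeries 𝒱.isLeftLeibniz_bracket k).sup isIdealOf_leibnizKernel

theorem radicalFiltration_le_solvableRadical (k : ℕ) :
    𝒱.radicalFiltration k ≤ solvableRadical 𝒱.bracket 𝒱.kernelAnnihilator :=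
  sup_le (isIdealOf_solvableRadical.isSubalgebra.derivedSeries_le k)
    (le_solvableRadical isIdealOf_leibnizKernel isSolvable_leibnizKernel)

theorem map₂_radicalFiltration_le (k : ℕ) :
    Submodule.map₂ 𝒱.bracket (𝒱.radicalFiltration k) (𝒱.radicalFiltration k) ≤
      𝒱.radicalFiltration (k + 1) :=
  isIdealOf_leibnizKernel.map₂_sup_le
    (isIdealOf_solvableRadical.derivedSeries 𝒱.isLeftLeibniz_bracket k).1

theorem exists_radicalFiltration_eq_leibnizKernel :
    ∃ k, 𝒱.radicalFiltration k = 𝒱.leibnizKernel := by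
  obtain ⟨k, hk⟩ := isSolvable_solvableRadical (β := 𝒱.bracket) (A := 𝒱.kernelAnnihilator)
  exact ⟨k, by rw [radicalFiltration, hk, bot_sup_eq]⟩

/-- The conjugating automorphism is `exp a(0)` for some `a ∈ [S₁, I]`. -/
theorem IsLevi.exists_map_le_sup_of_le_sup (h₁ : 𝒱.IsLevi S₁) (h₂ : 𝒱.IsLevi S₂)
    {I J : Submodule ℂ V} (hI : IsIdealOf 𝒱.bracket 𝒱.kernelAnnihilator I)
    (hJ : IsIdealOf 𝒱.bracket 𝒱.kernelAnnihilator J)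
    (hIB : I ≤ solvableRadical 𝒱.bracket 𝒱.kernelAnnihilator)
    (hII : Submodule.map₂ 𝒱.bracket I I ≤ J) (hNJ : 𝒱.leibnizKernel ≤ J) (hle : S₁ ≤ S₂ ⊔ I) :
    ∃ g ∈ 𝒱.aut, S₁.map (g : V →ₗ[ℂ] V) ≤ S₂ ⊔ J := by
  have hS₁F : S₁ ≤ 𝒱.kernelAnnihilator := IsLeviSubalgebra.le h₁
  obtain ⟨a, ha, hcorrect⟩ := exists_add_bracket_mem_sup 𝒱.isLeftLeibniz_bracket
    h₁.isSubalgebra h₁.alternating h₁.isSemisimple h₂.isSubalgebra (IsLeviSubalgebra.le h₂)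
    ((disjoint_iff.2 h₂.inf_eq).mono_right hIB) hI hJ hII
    (fun a ha b hb => hNJ (bracket_add_bracket_mem_leibnizKernel ha.1 hb.1)) hle
  have haI : a ∈ I := Submodule.map₂_le.2 (fun s hs x hx => (hI.2 s (hS₁F hs) x hx).1) ha
  have ha₁ : a ∈ 𝒱.weightSpace 1 := (hI.1 haI).1
  have haω : 𝒱.mode a 0 𝒱.conformal = 0 :=
    mode_zero_conformal_of_mem_map₂ (IsLeviSubalgebra.map₂_self h₁).ge hS₁F
      (Submodule.map₂_le_map₂_right (hI.1.trans kernelAnnihilator_le_weightSpace_one) ha) ha₁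
  refine ⟨expMode ha₁, expMode_mem_aut ha₁ haω, ?_⟩
  rintro _ ⟨s, hs, rfl⟩
  have hsq : 𝒱.mode a 0 (𝒱.mode a 0 s) ∈ J :=
    hII (Submodule.apply_mem_map₂ 𝒱.bracket haI (hI.2 s (hS₁F hs) a haI).2)
  have hexp : expMode ha₁ s - (s + 𝒱.bracket a s) ∈ J :=
    have := 𝒱.finiteDimensional
    gradedExp_apply_sub_mem 𝒱.isInternal (mode_zero_mem ha₁)
      (fun x hx => (hJ.2 a (hI.1 haI) x hx).1) (hS₁F hs).1 hsq
  have hadd := add_mem (Submodule.mem_sup_right (S := S₂) hexp) (hcorrect s hs)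
  rwa [sub_add_cancel] at hadd

theorem IsLevi.exists_map_le_sup_radicalFiltration (h₁ : 𝒱.IsLevi S₁) (h₂ : 𝒱.IsLevi S₂)
    (k : ℕ) : ∃ g ∈ 𝒱.aut, S₁.map (g : V →ₗ[ℂ] V) ≤ S₂ ⊔ 𝒱.radicalFiltration k := by
  induction k with
  | zero =>
    have hF : S₁ ≤ S₂ ⊔ solvableRadical 𝒱.bracket 𝒱.kernelAnnihilator :=
      (IsLeviSubalgebra.le h₁).trans h₂.sup_eq.ge
    refine ⟨1, one_mem _, ?_⟩
    rintro _ ⟨s, hs, rfl⟩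
    exact sup_le_sup_left le_sup_left S₂ (hF hs)
  | succ k ih =>
    obtain ⟨g, hg, hle⟩ := ih
    obtain ⟨g', hg', hle'⟩ := (h₁.map hg).exists_map_le_sup_of_le_sup h₂
      (isIdealOf_radicalFiltration k) (isIdealOf_radicalFiltration (k + 1))
      (radicalFiltration_le_solvableRadical k) (map₂_radicalFiltration_le k) le_sup_right hle
    exact ⟨g' * g, mul_mem hg' hg, (Submodule.map_comp _ _ S₁).trans_le hle'⟩

theorem IsLevi.exists_map_eq (h₁ : 𝒱.IsLevi S₁) (h₂ : 𝒱.IsLevi S₂) :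
    ∃ g ∈ 𝒱.aut, S₁.map (g : V →ₗ[ℂ] V) = S₂ := by
  obtain ⟨k, hk⟩ := exists_radicalFiltration_eq_leibnizKernel (𝒱 := 𝒱)
  obtain ⟨g, hg, hle⟩ := h₁.exists_map_le_sup_radicalFiltration h₂ k
  rw [hk] at hle
  have hle' := IsLeviSubalgebra.le_of_le_sup_of_central (h₁.map hg) h₂ isIdealOf_leibnizKernel.1
    (fun a ha x hx => ⟨ha.2 x hx, bracket_eq_zero_of_mem_leibnizKernel hx a⟩) hle
  exact ⟨g, hg, IsLeviSubalgebra.eq_of_le (h₁.map hg) h₂ hle'⟩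

end Conjugacy

theorem IsLevi.exists_affine_form {S : Submodule ℂ V} (h : 𝒱.IsLevi S)
    (hvac : 𝒱.vacuumLike ≤ ℂ ∙ 𝒱.vacuum) :
    ∃ α : LinearMap.BilinForm ℂ S, ∀ u v : S,
      𝒱.mode u 1 v = α u v • 𝒱.vacuum ∧
      ∀ m n : ℤ, ⁅𝒱.mode u m, 𝒱.mode v n⁆ =
        𝒱.mode (𝒱.mode u 0 v) (m + n) +
          (if m + n = 0 then (m : ℂ) * α u v else 0) • LinearMap.id :=
  VertexOperatorAlgebra.exists_affine_form (LeibnizAlg.IsLeviSubalgebra.map₂_self h).ge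
    (LeibnizAlg.IsLeviSubalgebra.le h) h.alternating hvac

end VertexOperatorAlgebra

theorem theorem2p2_general {V : Type*} [AddCommGroup V] [Module ℂ V]
    (𝒱 : VertexOperatorAlgebra V) :
    ((∀ g ∈ 𝒱.aut, ∀ S : Submodule ℂ V, 𝒱.IsLevi S → 𝒱.IsLevi (S.map (g : V →ₗ[ℂ] V))) ∧
      (∀ S₁ S₂ : Submodule ℂ V, 𝒱.IsLevi S₁ → 𝒱.IsLevi S₂ →
        ∃ g ∈ 𝒱.aut, S₁.map (g : V →ₗ[ℂ] V) = S₂)) ∧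
    (𝒱.vacuumLike ≤ ℂ ∙ 𝒱.vacuum → ∀ S : Submodule ℂ V, 𝒱.IsLevi S →
      ∃ α : LinearMap.BilinForm ℂ S, ∀ u v : S,
        𝒱.mode u 1 v = α u v • 𝒱.vacuum ∧
        ∀ m n : ℤ, ⁅𝒱.mode u m, 𝒱.mode v n⁆ =
          𝒱.mode (𝒱.mode u 0 v) (m + n) +
            (if m + n = 0 then (m : ℂ) * α u v else 0) • LinearMap.id) :=
  ⟨⟨fun _ hg _ hS => hS.map hg, fun _ _ h₁ h₂ => h₁.exists_map_eq h₂⟩,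
    fun hvac _ hS => hS.exists_affine_form hvac⟩

theorem theorem2p2 {V : Type*} [AddCommGroup V] [Module ℂ V] (𝒱 : VertexOperatorAlgebra V)
    (hsimple : 𝒱.IsSimple) :
    -- (a) `Aut(V)` acts on the set of Levi subalgebras of `F`, and the action is transitive
    ((∀ g ∈ 𝒱.aut, ∀ S : Submodule ℂ V, 𝒱.IsLevi S → 𝒱.IsLevi (S.map (g : V →ₗ[ℂ] V))) ∧
      (∀ S₁ S₂ : Submodule ℂ V, 𝒱.IsLevi S₁ → 𝒱.IsLevi S₂ →
        ∃ g ∈ 𝒱.aut, S₁.map (g : V →ₗ[ℂ] V) = S₂)) ∧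
    -- (b) the modes of the fields of a Levi subalgebra close on an affine algebra
    (∀ S : Submodule ℂ V, 𝒱.IsLevi S →
      ∃ α : LinearMap.BilinForm ℂ S, ∀ u v : S,
        𝒱.mode u 1 v = α u v • 𝒱.vacuum ∧
        ∀ m n : ℤ, ⁅𝒱.mode u m, 𝒱.mode v n⁆ =
          𝒱.mode (𝒱.mode u 0 v) (m + n) +
            (if m + n = 0 then (m : ℂ) * α u v else 0) • LinearMap.id) :=
  ⟨(theorem2p2_general 𝒱).1, (theorem2p2_general 𝒱).2 hsimple.vacuumLike_le⟩
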